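/- Notation. For $n\ge 0$ let $W^n$ be the set of $x=(x_1<\dots<x_n)$ with $x_i\in\mathbb N=\{0,1,2,\dots\}$. For $z\in W^n$ let $W^{n,n}(z)$ be the set of $y\in W^n$ with $y_1\le z_1<y_2\le z_2<\dots<y_n\le z_n$; for $x\in W^{n+1}$ let $W^{n,n+1}(x)$ be the set of $z\in W^n$ with $x_1\le z_1<x_2\le\dots\le z_n<x_{n+1}$, and let $W_{\mathrm{BC}}^{n,n+1}(x)$ be the set of $y\in W^n$ such that $y\in W^{n,n}(z)$ for some $z\in W^{n,n+1}(x)$. Let $a,b>-1$ be real and let $u,u'$ be both real or complex conjugates of each other. Put, for $x\in\mathbb N$, $$\beta_{u,u'}(x)=\frac{(x+a+b+1)(x+a+1)(x-u)(x-u')}{(2x+a+b+1)(2x+a+b+2)},\qquad \delta_{u,u'}(x)=\frac{x(x+b)(x+u+a+b+1)(x+u'+a+b+1)}{(2x+a+b+1)(2x+a+b)},$$ $$\mathsf f(x)=\frac{(2x+a+b+2)\,x!\,\Gamma(x+b+1)}{\Gamma(x+a+b+2)\Gamma(x+a+2)},\qquad \mathsf g(y)=\frac{(2y+a+b+1)\Gamma(y+a+b+1)\Gamma(y+a+1)}{y!\,\Gamma(y+b+1)},\qquad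 \mathsf B(x,y)=\tfrac12\mathsf f(x)\mathsf g(y),$$ where $\delta_{u,u'}(0)=0$ and, at $0$, the common factor $a+b+1$ is cancelled: $\beta_{u,u'}(0)=\frac{(a+1)uu'}{a+b+2}$ and $\mathsf g(0)=\frac{\Gamma(a+b+2)\Gamma(a+1)}{\Gamma(b+1)}$. Assume that the rates are positive, i.e. $\beta_{u,u'}(x)>0$, $\beta_{u+1,u'+1}(x)>0$ for $x\ge 0$ and $\delta_{u,u'}(x)>0$, $\delta_{u+1,u'+1}(x)>0$ for $x\ge 1$. Put $$\mathsf F_n(x)=\prod_{i<j}\Big(\big(x_j+\tfrac{a+b+1}{2}\big)^2-\big(x_i+\tfrac{a+b+1}{2}\big)^2\Big),\qquad c_n^{u,u'}=\frac{n(n-1)(n-2)}3-\frac{n(n-1)}2(u+u'+b),$$ $$\hat{\mathsf F}_n(z)=\sum_{y\in W^{n,n}(z)}\prod_{i=1}^n\mathsf g(y_i)\,\mathsf F_n(y),\qquad \bar{\mathsf F}_{n+1}(x)=\sum_{z\in W^{n,n+1}(x)}\prod_{i=1}^n\mathsf f(z_i)\,\hat{\mathsf F}_n(z),$$ and define the links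 $$(\mathfrak L^{\mathbf{BC}}_{n,n}f)(z)=\frac1{\hat{\mathsf F}_n(z)}\sum_{y\in W^{n,n}(z)}f(y)\prod_{i=1}^n\mathsf g(y_i)\,\mathsf F_n(y),\qquad (\mathfrak L^{\mathbf{BC}}_{n,n+1}f)(x)=\frac1{\bar{\mathsf F}_{n+1}(x)}\sum_{z\in W^{n,n+1}(x)}f(z)\prod_{i=1}^n\mathsf f(z_i)\,\hat{\mathsf F}_n(z),$$ $$(\mathfrak L^{\mathbf{BC}}_{n\to n+1}f)(x)=\frac{2^n\,n!\,\Gamma(n+a+1)}{\Gamma(a+1)\mathsf F_{n+1}(x)}\sum_{y\in W_{\mathrm{BC}}^{n,n+1}(x)}\mathsf F_n(y)f(y)\sum_{z:\,y\in W^{n,n}(z),\,z\in W^{n,n+1}(x)}\ \prod_{i=1}^n\mathsf B(z_i,y_i).$$ For a birth and death chain on $\mathbb N$ (killed at the death rate of $0$ when that is non-zero) with transition density $p_t(x,y)$, the Karlin-McGregor semigroup of $n$ such chains is $(P(t)f)(x)=\sum_{y\in W^n}\det\big(p_t(x_i,y_j)\big)_{i,j=1}^n f(y)$; if $P(t)h=e^{ct}h$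 for a strictly positive $h$ and all $t\ge0$, its $h$-transform is $P^h(t)=e^{-ct}h^{-1}\circ P(t)\circ h$. Let $P_n^{u,u'}$ be the Karlin-McGregor semigroup of $n$ chains with birth rate $\beta_{u,u'}$ and death rate $\delta_{u,u'}$, and $\mathsf P_n^{u,u'}$ that of $n$ chains with birth rate $\mathsf g(x)\beta_{u,u'}(x)/\mathsf g(x+1)$ and death rate $\mathsf g(x+1)\delta_{u,u'}(x+1)/\mathsf g(x)$, $x\in\mathbb N$ (in particular killed at $0$ at the rate $\mathsf g(1)\delta_{u,u'}(1)/\mathsf g(0)$). Theorem. Let $n\ge1$. The function $\mathsf F_n$ is a strictly positive eigenfunction of $P_n^{u,u'}(t)$ with eigenvalue $e^{c_n^{u,u'}t}$ for all $t\ge0$, and so is $\mathsf F_{n+1}$ of $P_{n+1}^{u+1,u'+1}(t)$ with eigenvalue $e^{c_{n+1}^{u+1,u'+1}t}$; $\hat{\mathsf F}_n$ is a strictly positive eigenfunction of $\mathsf P_n^{u,u'}(t)$ with eigenvalue $e^{\hat ct}$ for all $t\ge 0$, for some $\hat c\in\mathbb R$; and $\bar{\mathsf F}_{n+1}>0$.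 Moreover $\mathfrak L^{\mathbf{BC}}_{n\to n+1}=\mathfrak L^{\mathbf{BC}}_{n,n+1}\circ\mathfrak L^{\mathbf{BC}}_{n,n}$ and, for all $t\ge0$ and all bounded $f:W^n\to\mathbb R$ (in particular $f\in C_0(W^n)$), $$\mathsf P_n^{u,u',\hat{\mathsf F}_n}(t)\,\mathfrak L^{\mathbf{BC}}_{n,n}f=\mathfrak L^{\mathbf{BC}}_{n,n}\,P_n^{u,u',\mathsf F_n}(t)f,$$ $$P_{n+1}^{u+1,u'+1,\mathsf F_{n+1}}(t)\,\mathfrak L^{\mathbf{BC}}_{n,n+1}f=\mathfrak L^{\mathbf{BC}}_{n,n+1}\,\mathsf P_n^{u,u',\hat{\mathsf F}_n}(t)f,$$ $$P_{n+1}^{u+1,u'+1,\mathsf F_{n+1}}(t)\,\mathfrak L^{\mathbf{BC}}_{n\to n+1}f=\mathfrak L^{\mathbf{BC}}_{n\to n+1}\,P_n^{u,u',\mathsf F_n}(t)f.$$ -/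

import Mathlib

noncomputable section

namespace BCBranching

/-! ### Configurations and interlacing -/

/-- The discrete Weyl chamber `W^n`: strictly increasing `n`-tuples of natural numbers. -/
abbrev W (n : ℕ) : Type := {x : Fin n → ℕ // StrictMono x}

/-- `(z, y) ∈ W^{n,n}`: `y_1 ≤ z_1 < y_2 ≤ z_2 < ⋯ < y_n ≤ z_n`. -/
def InterlaceEq {n : ℕ} (z y : W n) : Prop :=
  (∀ i, y.1 i ≤ z.1 i) ∧ ∀ i j : Fin n, (i : ℕ) + 1 = j → z.1 i < y.1 j

/-- `(x, z) ∈ W^{n,n+1}`: `x_1 ≤ z_1 < x_2 ≤ z_2 < ⋯ ≤ z_n < x_{n+1}`. -/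
def InterlaceSucc {n : ℕ} (x : W (n + 1)) (z : W n) : Prop :=
  ∀ i : Fin n, x.1 i.castSucc ≤ z.1 i ∧ z.1 i < x.1 i.succ

theorem finite_of_le {n : ℕ} (S : Set (W n)) (m : Fin n → ℕ) (h : ∀ y ∈ S, y.1 ≤ m) :
    S.Finite :=
  Set.Finite.of_injOn (f := Subtype.val) (t := Set.Iic m) h
    Subtype.val_injective.injOn (Set.finite_Iic m)

theorem finite_interlaceEq {n : ℕ} (z : W n) : {y : W n | InterlaceEq z y}.Finite :=
  finite_of_le _ z.1 fun _ hy => hy.1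

theorem finite_interlaceSucc {n : ℕ} (x : W (n + 1)) : {z : W n | InterlaceSucc x z}.Finite :=
  finite_of_le _ (fun i => x.1 i.succ) fun _ hz i => (hz i).2.le

/-- The finite set `W^{n,n}(z)`. -/
def Wnn {n : ℕ} (z : W n) : Finset (W n) := (finite_interlaceEq z).toFinset

/-- The finite set `W^{n,n+1}(x)`. -/
def Wsucc {n : ℕ} (x : W (n + 1)) : Finset (W n) := (finite_interlaceSucc x).toFinset

theorem finite_interlaceBC {n : ℕ} (x : W (n + 1)) :
    {y : W n | ∃ z : W n, InterlaceEq z y ∧ InterlaceSucc x z}.Finite :=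
  finite_of_le _ (fun i => x.1 i.succ) fun _ ⟨_, h1, h2⟩ i => (h1.1 i).trans (h2 i).2.le

/-- The finite set `W_BC^{n,n+1}(x)` of `y` such that `y ∈ W^{n,n}(z)`, `z ∈ W^{n,n+1}(x)` for
some intermediate `z`. -/
def WBC {n : ℕ} (x : W (n + 1)) : Finset (W n) := (finite_interlaceBC x).toFinset

open Classical in
/-- The finite set of `z` with `y ∈ W^{n,n}(z)` and `z ∈ W^{n,n+1}(x)`. -/
def intermediate {n : ℕ} (x : W (n + 1)) (y : W n) : Finset (W n) :=
  (Wsucc x).filter fun z => InterlaceEq z y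

/-! ### Birth and death chains on `ℕ` and their Karlin-McGregor semigroups -/

/-- The rate matrix, restricted to `{0, …, N-1}`, of the birth and death chain with birth rates
`lam` and death rates `mu`. A death at `0`, possible only if `mu 0 ≠ 0`, kills the chain
(absorption at `-1`). -/
def rateMatrix (lam mu : ℕ → ℝ) (N : ℕ) : Matrix (Fin N) (Fin N) ℝ :=
  Matrix.of fun x y =>
    if (y : ℕ) = x + 1 then lam x
    else if (y : ℕ) + 1 = x then mu x
    else if y = x then -(lam x + mu x)
    else 0

/-- `p^N_t(x, y)`: the transition density of the chain killed when it leaves `{0, …, N-1}`. -/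
def truncatedDensity (lam mu : ℕ → ℝ) (N : ℕ) (t : ℝ) (x y : ℕ) : ℝ :=
  if h : x < N ∧ y < N then NormedSpace.exp (t • rateMatrix lam mu N) ⟨x, h.1⟩ ⟨y, h.2⟩ else 0

/-- The transition density `p_t(x, y)` of the birth and death chain with rates `lam`, `mu`:
the increasing limit of the densities of the chain killed on leaving `{0, …, N-1}`. (For
arbitrary rates this is the minimal nonnegative solution of the Kolmogorov backward equation with
`p_0(x, y) = δ_{x,y}`; it is the only nonnegative substochastic one when `∞` is natural.) -/
def transitionDensity (lam mu : ℕ → ℝ) (t : ℝ) (x y : ℕ) : ℝ :=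
  ⨆ N, truncatedDensity lam mu N t x y

/-- The Karlin-McGregor transition density `det (p_t(x_i, y_j))` of `n` chains killed when they
intersect. -/
def kmDensity (lam mu : ℕ → ℝ) {n : ℕ} (t : ℝ) (x y : W n) : ℝ :=
  Matrix.det (Matrix.of fun i j => transitionDensity lam mu t (x.1 i) (y.1 j))

/-- `h` is a strictly positive eigenfunction, with eigenvalue `e^{ct}`, of the Karlin-McGregor
semigroup of `n` chains with rates `lam`, `mu`. -/
def IsPosEigenfunction (lam mu : ℕ → ℝ) {n : ℕ} (h : W n → ℝ) (c : ℝ) : Prop :=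
  (∀ x, 0 < h x) ∧
    ∀ t : ℝ, 0 ≤ t → ∀ x, HasSum (fun y => kmDensity lam mu t x y * h y) (Real.exp (c * t) * h x)

/-- Doob's `h`-transform `e^{-ct} h⁻¹ ∘ P(t) ∘ h` of the Karlin-McGregor semigroup `P(t)` of `n`
chains with rates `lam`, `mu`, by an eigenfunction `h` with eigenvalue `e^{ct}`. -/
def doobKM (lam mu : ℕ → ℝ) {n : ℕ} (h : W n → ℝ) (c t : ℝ) (f : W n → ℝ) (x : W n) : ℝ :=
  Real.exp (-(c * t)) * (h x)⁻¹ * ∑' y, kmDensity lam mu t x y * (h y * f y)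

/-! ### Rates and weights -/

/-- The quotient `(x+a+b+1)/(2x+a+b+1)`, with its value `1` at `x = 0` also if `a+b+1 = 0`. -/
def betaQuotient (a b : ℝ) (x : ℕ) : ℝ :=
  if x = 0 then 1 else (x + a + b + 1) / (2 * x + a + b + 1)

/-- The birth rate
`β_{u,u'}(x) = (x+a+b+1)(x+a+1)(x-u)(x-u') / ((2x+a+b+1)(2x+a+b+2))`. The product
`(x-u)(x-u')` is real when `u, u'` are real or complex conjugates. -/
def birthRate (a b : ℝ) (u u' : ℂ) (x : ℕ) : ℝ :=
  betaQuotient a b x * ((x + a + 1) * (((x : ℂ) - u) * ((x : ℂ) - u')).re / (2 * x + a + b + 2))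

/-- The death rate
`δ_{u,u'}(x) = x(x+b)(x+u+a+b+1)(x+u'+a+b+1) / ((2x+a+b+1)(2x+a+b))`, so `δ_{u,u'}(0) = 0`. -/
def deathRate (a b : ℝ) (u u' : ℂ) (x : ℕ) : ℝ :=
  x * (x + b) * (((x : ℂ) + u + a + b + 1) * ((x : ℂ) + u' + a + b + 1)).re /
    ((2 * x + a + b + 1) * (2 * x + a + b))

theorem birthRate_eq (a b : ℝ) (hab : a + b + 1 ≠ 0) (u u' : ℝ) (x : ℕ) :
    birthRate a b u u' x =
      (x + a + b + 1) * (x + a + 1) * (x - u) * (x - u') /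
        ((2 * x + a + b + 1) * (2 * x + a + b + 2)) := by
  have hre : (((x : ℂ) - u) * ((x : ℂ) - u')).re = (x - u) * (x - u') := by
    simp
  have hq : betaQuotient a b x = (x + a + b + 1) / (2 * x + a + b + 1) := by
    unfold betaQuotient
    split_ifs with h
    · subst h
      simp [div_self hab]
    · rfl
  rw [birthRate, hre, hq, div_mul_div_comm]
  ring

/-- The rates of a reflecting chain on `ℕ` are positive: births everywhere, deaths off `0`. -/
def PositiveRates (a b : ℝ) (u u' : ℂ) : Prop :=
  (∀ x : ℕ, 0 < birthRate a b u u' x) ∧ ∀ x : ℕ, 1 ≤ x → 0 < deathRate a b u u' x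

/-- `f(x) = (2x+a+b+2) x! Γ(x+b+1) / (Γ(x+a+b+2) Γ(x+a+2))`. -/
def fWeight (a b : ℝ) (x : ℕ) : ℝ :=
  (2 * x + a + b + 2) * (x.factorial : ℝ) * Real.Gamma (x + b + 1) /
    (Real.Gamma (x + a + b + 2) * Real.Gamma (x + a + 2))

/-- The product `(2y+a+b+1) Γ(y+a+b+1)`, with its value `Γ(a+b+2)` at `y = 0` also if
`a+b+1 = 0`. -/
def gammaFactor (a b : ℝ) (y : ℕ) : ℝ :=
  if y = 0 then Real.Gamma (a + b + 2) else (2 * y + a + b + 1) * Real.Gamma (y + a + b + 1)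

/-- `g(y) = (2y+a+b+1) Γ(y+a+b+1) Γ(y+a+1) / (y! Γ(y+b+1))`. -/
def gWeight (a b : ℝ) (y : ℕ) : ℝ :=
  gammaFactor a b y * Real.Gamma (y + a + 1) / ((y.factorial : ℝ) * Real.Gamma (y + b + 1))

theorem gWeight_eq (a b : ℝ) (hab : a + b + 1 ≠ 0) (y : ℕ) :
    gWeight a b y =
      (2 * y + a + b + 1) * Real.Gamma (y + a + b + 1) * Real.Gamma (y + a + 1) /
        ((y.factorial : ℝ) * Real.Gamma (y + b + 1)) := by
  have hq : gammaFactor a b y = (2 * y + a + b + 1) * Real.Gamma (y + a + b + 1) := by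
    unfold gammaFactor
    split_ifs with h
    · subst h
      have := Real.Gamma_add_one hab
      rw [show a + b + 2 = a + b + 1 + 1 by ring, this]
      simp
    · rfl
  rw [gWeight, hq]

/-- `B(x, y) = f(x) g(y) / 2`. -/
def BWeight (a b : ℝ) (x y : ℕ) : ℝ := 1 / 2 * fWeight a b x * gWeight a b y

/-- The birth rate `g(x) β_{u,u'}(x) / g(x+1)` of the hidden chain. -/
def hiddenBirthRate (a b : ℝ) (u u' : ℂ) (x : ℕ) : ℝ :=
  gWeight a b x * birthRate a b u u' x / gWeight a b (x + 1)

/-- The death rate `g(x+1) δ_{u,u'}(x+1) / g(x)` of the hidden chain. -/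
def hiddenDeathRate (a b : ℝ) (u u' : ℂ) (x : ℕ) : ℝ :=
  gWeight a b (x + 1) * deathRate a b u u' (x + 1) / gWeight a b x

/-! ### Eigenfunctions and links -/

/-- `F_n(x) = ∏_{i<j} ((x_j + (a+b+1)/2)² - (x_i + (a+b+1)/2)²)`. -/
def F (a b : ℝ) {n : ℕ} (x : W n) : ℝ :=
  ∏ i : Fin n, ∏ j ∈ Finset.Ioi i,
    (((x.1 j : ℝ) + (a + b + 1) / 2) ^ 2 - ((x.1 i : ℝ) + (a + b + 1) / 2) ^ 2)

/-- `F̂_n(z) = ∑_{y ∈ W^{n,n}(z)} ∏_i g(y_i) F_n(y)`. -/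
def Fhat (a b : ℝ) {n : ℕ} (z : W n) : ℝ :=
  ∑ y ∈ Wnn z, (∏ i, gWeight a b (y.1 i)) * F a b y

/-- `F̄_{n+1}(x) = ∑_{z ∈ W^{n,n+1}(x)} ∏_i f(z_i) F̂_n(z)`. -/
def Fbar (a b : ℝ) {n : ℕ} (x : W (n + 1)) : ℝ :=
  ∑ z ∈ Wsucc x, (∏ i, fWeight a b (z.1 i)) * Fhat a b z

/-- The kernel `L^BC_{n,n}` from `W^n` to `W^n`. -/
def linkEq (a b : ℝ) {n : ℕ} (f : W n → ℝ) (z : W n) : ℝ :=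
  (Fhat a b z)⁻¹ * ∑ y ∈ Wnn z, f y * (∏ i, gWeight a b (y.1 i)) * F a b y

/-- The kernel `L^BC_{n,n+1}` from `W^{n+1}` to `W^n`. -/
def linkSucc (a b : ℝ) {n : ℕ} (f : W n → ℝ) (x : W (n + 1)) : ℝ :=
  (Fbar a b x)⁻¹ * ∑ z ∈ Wsucc x, f z * (∏ i, fWeight a b (z.1 i)) * Fhat a b z

/-- The kernel `L^BC_{n→n+1}` from `W^{n+1}` to `W^n` of the BC-type branching graph. -/
def linkBC (a b : ℝ) {n : ℕ} (f : W n → ℝ) (x : W (n + 1)) : ℝ :=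
  2 ^ n * (n.factorial : ℝ) * Real.Gamma (n + a + 1) / (Real.Gamma (a + 1) * F a b x) *
    ∑ y ∈ WBC x, F a b y * f y * ∑ z ∈ intermediate x y, ∏ i, BWeight a b (z.1 i) (y.1 i)

/-- `c_n = n(n-1)(n-2)/3 - (n(n-1)/2)(u+u'+b)`; `u+u'` is real when `u, u'` are real or complex
conjugates. -/
def eigenExponent (b : ℝ) (u u' : ℂ) (n : ℕ) : ℝ :=
  (n : ℝ) * (n - 1) * (n - 2) / 3 - (n : ℝ) * (n - 1) / 2 * ((u + u').re + b)

end BCBranching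

end

open BCBranching

/-!
# Intertwinings for the BC branching graph

One particle. Write `s = a + b + 1`. The generator of the chain acts triangularly on the polynomials
`q_j(x) = ∏_{i<j} (x-i)(x+s+i)`, which are monic of degree `j` in `(x+s/2)²`: it maps `q_j` into
the span of `q_j` and `q_{j-1}` (`generator_chamberPoly_succ`). The weight `g` is an eigenmeasure of
the chain (`gWeight_eigenmeasure_succ`), so summation `h ↦ ∑_{y ≤ z} g(y) h(y)` carries its
generator to that of the hidden chain, up to a constant (`generator_cumSum`). In the same way the
differences `(h(x) - h(x+1)) / f(x)` carry the generator with parameters `u+1`, `u'+1` to that of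
the hidden chain (`generator_diff`).

From generators to semigroups. The transition density is the limit of those of the chains truncated
to `{0, …, N}`. By Duhamel's formula, a solution of the backward equation inside `{0, …, N}` differs
from the truncated semigroup by what leaves through `N` (`hasDerivAt_duhamel`), and this vanishes in
the limit as soon as the solution is small compared with a function that the generator increases at
most exponentially (`IsLyapunov.tendsto_sum_truncatedDensity_sub`). The sums `q_0 + ⋯ + q_K`, and
their images under summation against `g`, are such functions (`TriangularChain`), and raising `K`
lets them outgrow the birth rate times any given one of them. Hence the one-particle semigroups act triangularly as well, and
the two identities for generators become identities for semigroups: `hasSum_hidden_mul_indicator`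
and `fWeight_mul_sum_sub`.

Several particles. Both interlacing relations have determinants as their indicators
(`det_le_eq_interlaceEq`, `det_diff_eq_interlaceSucc`), so the links, like the Karlin-McGregor
densities, are determinantal kernels, and the Cauchy-Binet formula with infinitely many indices
(`hasSum_det_mul_det`) turns products of determinants into determinants of one-particle
quantities. `F_n` is the determinant of the `q_j(x_i)` and `F̂_n` that of their sums against `g`, so
they are eigenfunctions, with the sum of the first `n` diagonal coefficients as exponent
(`TriangularChain.hasSum_kmDensity`). Summation of these sums against `f` gives back a multiple of
`q_{j+1}`, and so `F̄_{n+1}` is a multiple of `F_{n+1}` (`Fbar_eq`); this also yields the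
factorization of the link of the branching graph (`linkBC_eq_comp`). The unnormalized links intertwine
the Karlin-McGregor densities (`hasSum_kmDensity_mul_interlaceEq`,
`hasSum_kmDensity_mul_interlaceSucc`), and Fubini's theorem passes to the `h`-transforms acting on
bounded functions (`doobKM_intertwining`).
-/

noncomputable section

namespace BCBranching

/-! ### Infinite Cauchy-Binet formula -/

theorem summable_mul_of_summable_abs {α β : Type*} (f : α → ℝ) (g : β → ℝ)
    (hf : Summable fun y => |f y|) (hg : Summable fun y => |g y|) :
    Summable fun p : α × β => f p.1 * g p.2 := by
  have hf' : Summable fun y => ‖f y‖ := hf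
  have hg' : Summable fun y => ‖g y‖ := hg
  exact summable_mul_of_summable_norm hf' hg'

/-- Products of absolutely convergent series are summed over all tuples of indices. -/
theorem hasSum_pi_prod {n : ℕ} (f : Fin n → ℕ → ℝ) (hf : ∀ i, Summable fun y => |f i y|) :
    Summable (fun y : Fin n → ℕ => |∏ i, f i (y i)|) ∧
      HasSum (fun y : Fin n → ℕ => ∏ i, f i (y i)) (∏ i, ∑' y, f i y) := by
  induction n with
  | zero =>
    refine ⟨(hasSum_fintype _).summable, ?_⟩
    simp
  | succ n ih =>
    obtain ⟨h1, h2⟩ := ih (fun i => f i.succ) fun i => hf i.succ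
    have h0 : HasSum (f 0) (∑' y, f 0 y) := (hf 0).of_abs.hasSum
    let G : (Fin n → ℕ) → ℝ := fun y => ∏ i, f i.succ (y i)
    have hs := summable_mul_of_summable_abs (f 0) G (hf 0) h1
    have hm := h0.mul h2 hs
    have key : (fun p : ℕ × (Fin n → ℕ) => f 0 p.1 * G p.2) =
        (fun y : Fin (n + 1) → ℕ => ∏ i, f i (y i)) ∘ (Fin.consEquiv fun _ => ℕ) := by
      funext p
      simp [Fin.prod_univ_succ, Fin.consEquiv, G]
    rw [key] at hm hs
    rw [Fin.prod_univ_succ]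
    refine ⟨?_, (Equiv.hasSum_iff _).1 hm⟩
    exact ((Equiv.summable_iff _).1 hs).abs

/-- Every injective tuple is, in exactly one way, a permutation of an increasing one. -/
theorem injective_comp_perm (n : ℕ) :
    Function.Injective fun p : W n × Equiv.Perm (Fin n) => (p.1.1 ∘ p.2 : Fin n → ℕ) := by
  rintro ⟨x, σ⟩ ⟨y, τ⟩ h
  have h' : x.1 ∘ σ = y.1 ∘ τ := h
  have hr : Set.range x.1 = Set.range y.1 := by
    have := congrArg Set.range h'
    rwa [σ.surjective.range_comp, τ.surjective.range_comp] at this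
  have hxy : x = y := Subtype.ext ((StrictMono.range_inj x.2 y.2).1 hr)
  subst hxy
  have : σ = τ := Equiv.ext fun i => x.2.injective (congrFun h' i)
  rw [this]

theorem exists_perm_of_injective {n : ℕ} (y : Fin n → ℕ) (hy : Function.Injective y) :
    ∃ p : W n × Equiv.Perm (Fin n), (p.1.1 ∘ p.2 : Fin n → ℕ) = y := by
  refine ⟨(⟨y ∘ Tuple.sort y, ?_⟩, (Tuple.sort y)⁻¹), ?_⟩
  · exact (Tuple.monotone_sort y).strictMono_of_injective
      (hy.comp (Tuple.sort y).injective)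
  · funext i
    simp

/-- The Cauchy-Binet formula with an infinite inner index. -/
theorem hasSum_det_mul_det {n : ℕ} (A : Fin n → ℕ → ℝ) (B : ℕ → Fin n → ℝ)
    (h : ∀ i k, Summable fun y => |A i y * B y k|) :
    HasSum (fun y : W n => Matrix.det (Matrix.of fun i j => A i (y.1 j)) *
        Matrix.det (Matrix.of fun i j => B (y.1 i) j))
      (Matrix.det (Matrix.of fun i k => ∑' y, A i y * B y k)) := by
  -- The sum over all tuples `y : Fin n → ℕ` of `∏ A i (y i) * det (B (y i) k)`.
  have h1 : HasSum (fun y : Fin n → ℕ => (∏ i, A i (y i)) *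
      Matrix.det (Matrix.of fun i k => B (y i) k))
      (Matrix.det (Matrix.of fun i k => ∑' y, A i y * B y k)) := by
    have h2 : ∀ σ : Equiv.Perm (Fin n), HasSum
        (fun y : Fin n → ℕ => ((Equiv.Perm.sign σ : ℤ) : ℝ) *
          ∏ i, A i (y i) * B (y i) (σ i))
        (((Equiv.Perm.sign σ : ℤ) : ℝ) * ∏ i, ∑' y, A i y * B y (σ i)) := fun σ =>
      (hasSum_pi_prod (fun i y => A i y * B y (σ i)) fun i => h i (σ i)).2.mul_left _
    have h3 := hasSum_sum (s := Finset.univ) fun σ (_ : σ ∈ Finset.univ) => h2 σ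
    have e1 : Matrix.det (Matrix.of fun i k => ∑' y, A i y * B y k) =
        ∑ σ : Equiv.Perm (Fin n), ((Equiv.Perm.sign σ : ℤ) : ℝ) *
          ∏ i, ∑' y, A i y * B y (σ i) := by
      rw [← Matrix.det_transpose, Matrix.det_apply']
      rfl
    rw [e1]
    refine h3.congr_fun ?_
    intro y
    rw [← Matrix.det_transpose, Matrix.det_apply', Finset.mul_sum]
    refine Finset.sum_congr rfl fun σ _ => ?_
    simp only [Matrix.transpose_apply, Matrix.of_apply, Finset.prod_mul_distrib]
    ring
  -- Only injective tuples contribute.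
  have h4 := ((injective_comp_perm n).hasSum_iff (f := fun y : Fin n → ℕ => (∏ i, A i (y i)) *
      Matrix.det (Matrix.of fun i k => B (y i) k)) (by
    intro y hy
    have : ¬ Function.Injective y := fun hinj => hy (exists_perm_of_injective y hinj)
    simp only [Function.Injective, not_forall] at this
    obtain ⟨i, j, hij, hne⟩ := this
    rw [Matrix.det_zero_of_row_eq hne, mul_zero]
    funext k
    simp [hij])).2 h1
  refine (h4.prod_fiberwise fun y => hasSum_fintype _).congr_fun ?_
  intro y
  simp only [Function.comp]
  rw [← Matrix.det_transpose, Matrix.det_apply', Finset.sum_mul]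
  refine Finset.sum_congr rfl fun σ _ => ?_
  have := Matrix.det_permute σ (Matrix.of fun i k => B (y.1 i) k)
  rw [show (Matrix.of fun i k => B (y.1 (σ i)) k) =
    (Matrix.of fun i k => B (y.1 i) k).submatrix σ id from rfl, this]
  simp only [Matrix.transpose_apply, Matrix.of_apply]
  ring

/-! ### Determinantal form of interlacing -/

/-- The determinant of the indicator of a relation on `Fin n` whose rows are initial segments of
increasing length is the indicator of the relation being `j ≤ i`. -/
theorem det_indicator_staircase {n : ℕ} (R : Fin n → Fin n → Prop) [∀ i j, Decidable (R i j)]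
    (hdown : ∀ i j j', j' ≤ j → R i j → R i j') (hup : ∀ i i' j, i ≤ i' → R i j → R i' j)
    [Decidable (∀ i j, R i j ↔ j ≤ i)] :
    Matrix.det (Matrix.of fun i j => if R i j then (1 : ℝ) else 0) =
      if ∀ i j, R i j ↔ j ≤ i then 1 else 0 := by
  split_ifs with hR
  · rw [Matrix.det_of_isLowerTriangular]
    · refine Finset.prod_eq_one fun i _ => ?_
      simp [hR]
    · intro i j hij
      have : i < j := hij
      simp [hR, this]
  · by_cases h0 : ∃ i, ∀ j, ¬ R i j
    · obtain ⟨i, hi⟩ := h0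
      exact Matrix.det_eq_zero_of_row_eq_zero i fun j => by simp [hi]
    push Not at h0
    -- `top i` is the last index of row `i`.
    have htop : ∀ i, ∃ m, ∀ j, R i j ↔ j ≤ m := by
      intro i
      obtain ⟨j, hj⟩ := h0 i
      have hne : (Finset.univ.filter fun j => R i j).Nonempty := ⟨j, by simp [hj]⟩
      refine ⟨Finset.max' _ hne, fun k => ⟨fun hk => Finset.le_max' _ k
        (Finset.mem_filter.2 ⟨Finset.mem_univ _, hk⟩), fun hk => ?_⟩⟩
      have := Finset.max'_mem _ hne
      exact hdown i _ k hk (Finset.mem_filter.1 this).2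
    choose top htop using htop
    by_cases hinj : Function.Injective top
    · exfalso
      have hmono : Monotone top := fun i i' hii => (htop i' _).1
        (hup i i' _ hii ((htop i _).2 le_rfl))
      have hst := hmono.strictMono_of_injective hinj
      have hid : top = id := by
        have hsurj : Function.Surjective top := Finite.surjective_of_injective hinj
        have : hst.orderIsoOfSurjective top hsurj = OrderIso.refl _ := Subsingleton.elim _ _
        funext i
        exact congrArg (fun e : Fin n ≃o Fin n => e i) this
      exact hR fun i j => by rw [htop, hid]; rfl
    · simp only [Function.Injective, not_forall] at hinj
      obtain ⟨i, j, hij, hne⟩ := hinj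
      refine Matrix.det_zero_of_row_eq hne ?_
      funext k
      simp [htop, hij]

open Classical in
/-- The interlacing of `W^{n,n}` as a determinant. -/
theorem det_le_eq_interlaceEq {n : ℕ} (z y : W n) (g : ℕ → ℝ) :
    Matrix.det (Matrix.of fun i j => if y.1 j ≤ z.1 i then g (y.1 j) else 0) =
      if InterlaceEq z y then ∏ j, g (y.1 j) else 0 := by
  have h1 : (Matrix.of fun i j => if y.1 j ≤ z.1 i then g (y.1 j) else 0) =
      Matrix.of fun i j => g (y.1 j) *
        (Matrix.of fun i j => if y.1 j ≤ z.1 i then (1 : ℝ) else 0) i j := by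
    ext i j
    simp
  rw [h1, Matrix.det_mul_row, det_indicator_staircase (fun i j => y.1 j ≤ z.1 i)]
  · have : (∀ i j, y.1 j ≤ z.1 i ↔ j ≤ i) ↔ InterlaceEq z y := by
      constructor
      · intro h
        refine ⟨fun i => (h i i).2 le_rfl, fun i j hij => ?_⟩
        by_contra hlt
        have := (h i j).1 (not_lt.1 hlt)
        rw [Fin.le_def] at this
        omega
      · rintro ⟨h1, h2⟩ i j
        refine ⟨fun h => ?_, fun h => (y.2.monotone h).trans (h1 i)⟩
        by_contra hlt
        have hij : i < j := not_le.1 hlt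
        have hlt' : (i : ℕ) + 1 < n := by have := j.2; rw [Fin.lt_def] at hij; omega
        have h3 := h2 i ⟨i + 1, hlt'⟩ rfl
        have h4 : y.1 ⟨i + 1, hlt'⟩ ≤ y.1 j := y.2.monotone (by
          rw [Fin.le_def]; rw [Fin.lt_def] at hij; exact hij)
        omega
    simp only [this]
    split_ifs <;> simp
  · exact fun i j j' hj h => (y.2.monotone hj).trans h
  · exact fun i i' j hi h => h.trans (z.2.monotone hi)

/-- A determinant bordered by a column of ones is the determinant of the row differences. -/
theorem det_cons_one {n : ℕ} (φ : Fin (n + 1) → Fin n → ℝ) :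
    Matrix.det (Matrix.of fun i (j : Fin (n + 1)) =>
        (Fin.cons 1 (φ i) : Fin (n + 1) → ℝ) j) =
      Matrix.det (Matrix.of fun i j => φ i.succ j - φ i.castSucc j) := by
  rw [Matrix.det_eq_of_forall_row_eq_smul_add_pred (B := Matrix.of fun i (j : Fin (n + 1)) =>
      (Fin.cases (Fin.cons 1 (φ 0) : Fin (n + 1) → ℝ)
        (fun i => Fin.cons 0 fun j => φ i.succ j - φ i.castSucc j) i : Fin (n + 1) → ℝ) j)
      (fun _ => 1)]
  · rw [Matrix.det_succ_column_zero, Fin.sum_univ_succ]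
    simp
    rfl
  · intro j
    simp
  · intro i j
    refine Fin.cases ?_ (fun k => ?_) j <;> simp

open Classical in
/-- The interlacing of `W^{n,n+1}` as a determinant. -/
theorem det_diff_eq_interlaceSucc {n : ℕ} (x : W (n + 1)) (z : W n) (f : ℕ → ℝ) :
    Matrix.det (Matrix.of fun i j : Fin n => (if z.1 j < x.1 i.succ then f (z.1 j) else 0) -
        if z.1 j < x.1 i.castSucc then f (z.1 j) else 0) =
      if InterlaceSucc x z then ∏ j, f (z.1 j) else 0 := by
  have h1 : (Matrix.of fun i j : Fin n => (if z.1 j < x.1 i.succ then f (z.1 j) else 0) -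
        if z.1 j < x.1 i.castSucc then f (z.1 j) else 0) =
      Matrix.of fun i j => f (z.1 j) *
        (Matrix.of fun i j : Fin n => (if z.1 j < x.1 i.succ then (1 : ℝ) else 0) -
          if z.1 j < x.1 i.castSucc then (1 : ℝ) else 0) i j := by
    ext i j
    simp [mul_sub]
  rw [h1, Matrix.det_mul_row, ← det_cons_one fun i j => if z.1 j < x.1 i then (1 : ℝ) else 0]
  have h2 : (Matrix.of fun i (j : Fin (n + 1)) =>
      (Fin.cons 1 (fun j => if z.1 j < x.1 i then (1 : ℝ) else 0) : Fin (n + 1) → ℝ) j) =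
      Matrix.of fun i (j : Fin (n + 1)) =>
        if (Fin.cases True (fun j => z.1 j < x.1 i) j : Prop) then (1 : ℝ) else 0 := by
    ext i j
    refine Fin.cases (by simp) (fun k => ?_) j
    by_cases h : z.1 k < x.1 i <;> simp [h]
  rw [h2, det_indicator_staircase]
  · have : (∀ (i j : Fin (n + 1)), (Fin.cases True (fun j => z.1 j < x.1 i) j : Prop) ↔ j ≤ i) ↔
        InterlaceSucc x z := by
      constructor
      · intro h i
        refine ⟨?_, ?_⟩
        · by_contra hlt
          have := (h i.castSucc i.succ).1 (by simpa using hlt)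
          rw [Fin.le_def] at this
          simp at this
        · exact (h i.succ i.succ).2 le_rfl
      · intro h i j
        refine Fin.cases (by simp) (fun j => ?_) j
        change z.1 j < x.1 i ↔ _
        constructor
        · intro hlt
          by_contra hle
          have hle' : i ≤ j.castSucc := by
            rw [Fin.le_def] at *
            simp at *
            omega
          have := x.2.monotone hle'
          have := (h j).1
          omega
        · intro hle
          exact (h j).2.trans_le (x.2.monotone hle)
    simp only [this]
    split_ifs <;> simp
  · intro i j j' hj
    refine Fin.cases (fun _ => ?_) (fun j' hj => ?_) j' hj
    · simp
    · refine Fin.cases (fun hj => ?_) (fun j hj h => ?_) j hj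
      · exact absurd hj (by simp)
      · exact (z.2.monotone (Fin.succ_le_succ_iff.1 hj)).trans_lt h
  · intro i i' j hi
    refine Fin.cases (fun _ => ?_) (fun j h => ?_) j
    · simp
    · exact lt_of_lt_of_le h (x.2.monotone hi)

/-! ### Truncated transition densities -/

/-- The generator of the birth and death chain with birth rates `lam` and death rates `mu`, killed
at `0` at rate `mu 0`: functions are extended by `h (-1) = 0`. -/
def generator (lam mu h : ℕ → ℝ) (x : ℕ) : ℝ :=
  lam x * (h (x + 1) - h x) - mu x * (h x - if x = 0 then 0 else h (x - 1))

/-- The entries of `rateMatrix`, as a function on `ℕ × ℕ`. -/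
def rateEntry (lam mu : ℕ → ℝ) (x y : ℕ) : ℝ :=
  if y = x + 1 then lam x else if y + 1 = x then mu x else if y = x then -(lam x + mu x) else 0

theorem rateMatrix_apply (lam mu : ℕ → ℝ) (N : ℕ) (x y : Fin N) :
    rateMatrix lam mu N x y = rateEntry lam mu x y := by
  simp [rateMatrix, rateEntry, Fin.ext_iff]

/-- A row of the truncated rate matrix acts as the generator, except that the last row loses the
value beyond the truncation. -/
theorem sum_rateEntry_mul (lam mu h : ℕ → ℝ) {N x : ℕ} (hx : x ≤ N) :
    ∑ y ∈ Finset.range (N + 1), rateEntry lam mu x y * h y =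
      generator lam mu h x - if x = N then lam N * h (N + 1) else 0 := by
  have h1 : ∀ y ∈ Finset.range (N + 1), rateEntry lam mu x y * h y =
      ((if y = x + 1 then lam x * h (x + 1) else 0) +
        if y = x - 1 then (if x = 0 then 0 else mu x * h (x - 1)) else 0) +
        if y = x then -(lam x + mu x) * h x else 0 := by
    intro y _
    unfold rateEntry
    rcases Nat.eq_zero_or_pos x with rfl | hx0
    · by_cases h1 : y = 1
      · simp [h1]
      · by_cases h2 : y = 0 <;> simp [h1, h2]
    · by_cases h1 : y = x + 1
      · have h2 : x ≠ 0 := by omega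
        have h3 : x + 1 ≠ x - 1 := by omega
        simp [h1, h3]
      · by_cases h2 : y + 1 = x
        · subst h2
          simp [show y ≠ y + 1 + 1 by omega]
        · have h3 : y ≠ x - 1 := by omega
          by_cases h4 : y = x
          · simp [h4, hx0.ne']
            intro h5
            omega
          · simp [h1, h2, h3, h4]
  rw [Finset.sum_congr rfl h1, Finset.sum_add_distrib, Finset.sum_add_distrib,
    Finset.sum_ite_eq', Finset.sum_ite_eq', Finset.sum_ite_eq']
  have h2 : x - 1 ∈ Finset.range (N + 1) := by simp; omega
  have h3 : x ∈ Finset.range (N + 1) := by simp; omega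
  rw [if_pos h2, if_pos h3]
  unfold generator
  by_cases hN : x = N
  · subst hN
    by_cases h0 : x = 0
    · simp [h0]; ring
    · simp [h0]; ring
  · have h4 : x + 1 ∈ Finset.range (N + 1) := by simp; omega
    rw [if_pos h4, if_neg hN]
    by_cases h0 : x = 0
    · simp [h0]; ring
    · simp [h0]; ring

section MatrixExp

open scoped Matrix.Norms.Operator

theorem hasDerivAt_exp_smul_apply {m : Type*} [Fintype m] [DecidableEq m] (A : Matrix m m ℝ)
    (s : ℝ) (i j : m) :
    HasDerivAt (fun s : ℝ => NormedSpace.exp (s • A) i j) ((NormedSpace.exp (s • A) * A) i j) s :=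
  (LinearMap.toContinuousLinearMap (Matrix.entryLinearMap ℝ ℝ i j)).hasFDerivAt.comp_hasDerivAt s
    (hasDerivAt_exp_smul_const A s)

theorem hasDerivAt_exp_smul_apply' {m : Type*} [Fintype m] [DecidableEq m] (A : Matrix m m ℝ)
    (s : ℝ) (i j : m) :
    HasDerivAt (fun s : ℝ => NormedSpace.exp (s • A) i j) ((A * NormedSpace.exp (s • A)) i j) s :=
  (LinearMap.toContinuousLinearMap (Matrix.entryLinearMap ℝ ℝ i j)).hasFDerivAt.comp_hasDerivAt s
    (hasDerivAt_exp_smul_const' A s)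

theorem exp_apply_nonneg {m : Type*} [Fintype m] [DecidableEq m] (B : Matrix m m ℝ)
    (hB : ∀ i j, 0 ≤ B i j) (i j : m) : 0 ≤ NormedSpace.exp B i j := by
  have hpow : ∀ k : ℕ, ∀ i j, 0 ≤ (B ^ k) i j := by
    intro k
    induction k with
    | zero =>
      intro i j
      rw [pow_zero, Matrix.one_apply]
      split_ifs <;> norm_num
    | succ k ih =>
      intro i j
      rw [pow_succ, Matrix.mul_apply]
      exact Finset.sum_nonneg fun l _ => mul_nonneg (ih i l) (hB l j)
  have h := NormedSpace.exp_series_hasSum_exp' (𝕂 := ℝ) B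
  have h' := (LinearMap.toContinuousLinearMap (Matrix.entryLinearMap ℝ ℝ i j)).hasSum h
  refine h'.nonneg fun k => ?_
  change 0 ≤ (((k.factorial : ℝ)⁻¹ • B ^ k) i j)
  rw [Matrix.smul_apply]
  exact smul_nonneg (by positivity) (hpow k i j)

/-- The exponential of a matrix with nonnegative off-diagonal entries is nonnegative. -/
theorem exp_apply_nonneg_of_offDiag {m : Type*} [Fintype m] [DecidableEq m] (A : Matrix m m ℝ)
    (hA : ∀ i j, i ≠ j → 0 ≤ A i j) (i j : m) : 0 ≤ NormedSpace.exp A i j := by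
  -- Shifting the diagonal by a large `c` makes all entries nonnegative and costs a factor `e^{-c}`.
  set c : ℝ := ∑ k, |A k k| with hc
  have hcA : ∀ k, 0 ≤ A k k + c := fun k => by
    have := Finset.single_le_sum (f := fun k => |A k k|) (fun k _ => abs_nonneg _)
      (Finset.mem_univ k)
    rw [← hc] at this
    linarith [neg_abs_le (A k k)]
  have hdec : A = (A + Matrix.diagonal fun _ => c) + Matrix.diagonal fun _ => -c := by
    rw [add_assoc, Matrix.diagonal_add]
    simp
  have hcomm : Commute (A + Matrix.diagonal fun _ => c) (Matrix.diagonal fun _ => -c) := by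
    rw [show (Matrix.diagonal fun _ => -c : Matrix m m ℝ) = (-c) • 1 by
      rw [← Matrix.diagonal_one, ← Matrix.diagonal_smul]; congr 1; funext; simp]
    exact (Commute.one_right _).smul_right _
  rw [hdec, Matrix.exp_add_of_commute _ _ hcomm, Matrix.exp_diagonal, Matrix.mul_diagonal]
  refine mul_nonneg (exp_apply_nonneg _ (fun k l => ?_) i j) ?_
  · by_cases h : k = l
    · subst h
      simpa using hcA k
    · simpa [Matrix.diagonal_apply_ne _ h] using hA k l h
  · rw [Pi.coe_exp, ← Real.exp_eq_exp_ℝ]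
    exact (Real.exp_pos _).le

end MatrixExp

section Truncated

variable {lam mu : ℕ → ℝ} {N : ℕ}

theorem truncatedDensity_of_lt {x y : ℕ} (t : ℝ) (hx : x < N) (hy : y < N) :
    truncatedDensity lam mu N t x y =
      NormedSpace.exp (t • rateMatrix lam mu N) ⟨x, hx⟩ ⟨y, hy⟩ := by
  rw [truncatedDensity, dif_pos ⟨hx, hy⟩]

theorem truncatedDensity_of_le_left {x y : ℕ} (t : ℝ) (hx : N ≤ x) :
    truncatedDensity lam mu N t x y = 0 := by
  rw [truncatedDensity, dif_neg (by omega)]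

theorem truncatedDensity_of_le_right {x y : ℕ} (t : ℝ) (hy : N ≤ y) :
    truncatedDensity lam mu N t x y = 0 := by
  rw [truncatedDensity, dif_neg (by omega)]

theorem truncatedDensity_zero {x y : ℕ} (hx : x < N) :
    truncatedDensity lam mu N 0 x y = if x = y then 1 else 0 := by
  by_cases hy : y < N
  · rw [truncatedDensity_of_lt 0 hx hy, zero_smul, NormedSpace.exp_zero, Matrix.one_apply]
    simp
  · rw [truncatedDensity_of_le_right 0 (not_lt.1 hy), if_neg (by omega)]

theorem truncatedDensity_nonneg (hlam : ∀ x, 0 ≤ lam x) (hmu : ∀ x, 0 ≤ mu x) {t : ℝ}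
    (ht : 0 ≤ t) (x y : ℕ) : 0 ≤ truncatedDensity lam mu N t x y := by
  unfold truncatedDensity
  split_ifs with h
  · refine exp_apply_nonneg_of_offDiag _ (fun i j hij => ?_) _ _
    rw [Matrix.smul_apply, rateMatrix_apply, smul_eq_mul]
    refine mul_nonneg ht ?_
    unfold rateEntry
    have : (j : ℕ) ≠ i := fun h => hij (Fin.ext h.symm)
    split_ifs
    · exact hlam _
    · exact hmu _
    · exact le_rfl
  · exact le_rfl

/-- Forward equation of the truncated chain. -/
theorem hasDerivAt_truncatedDensity_forward {x y : ℕ} (hx : x < N) (hy : y < N) (s : ℝ) :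
    HasDerivAt (fun s => truncatedDensity lam mu N s x y)
      (∑ k ∈ Finset.range N, truncatedDensity lam mu N s x k * rateEntry lam mu k y) s := by
  have h := hasDerivAt_exp_smul_apply (rateMatrix lam mu N) s ⟨x, hx⟩ ⟨y, hy⟩
  simp only [truncatedDensity_of_lt _ hx hy]
  convert h using 1
  rw [Matrix.mul_apply, Finset.sum_range]
  refine Finset.sum_congr rfl fun k _ => ?_
  rw [truncatedDensity_of_lt _ hx k.2, rateMatrix_apply]

/-- Backward equation of the truncated chain. -/
theorem hasDerivAt_truncatedDensity_backward {x : ℕ} (hx : x ≤ N) (y : ℕ) (s : ℝ) :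
    HasDerivAt (fun s => truncatedDensity lam mu (N + 1) s x y)
      (generator lam mu (fun k => truncatedDensity lam mu (N + 1) s k y) x) s := by
  by_cases hy : y < N + 1
  · have hx' : x < N + 1 := by omega
    have h := hasDerivAt_exp_smul_apply' (rateMatrix lam mu (N + 1)) s ⟨x, hx'⟩ ⟨y, hy⟩
    simp only [truncatedDensity_of_lt _ hx' hy]
    convert h using 1
    have h2 := sum_rateEntry_mul lam mu (fun k => truncatedDensity lam mu (N + 1) s k y) hx
    rw [truncatedDensity_of_le_left s le_rfl, mul_zero, ite_self, sub_zero] at h2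
    rw [← h2, Matrix.mul_apply, Finset.sum_range]
    refine Finset.sum_congr rfl fun k _ => ?_
    rw [truncatedDensity_of_lt _ k.2 hy, rateMatrix_apply]
  · have h0 : ∀ s k, truncatedDensity lam mu (N + 1) s k y = 0 := fun s k =>
      truncatedDensity_of_le_right s (not_lt.1 hy)
    simp only [h0]
    simpa [generator] using hasDerivAt_const s (0 : ℝ)

/-- Duhamel's formula: along a curve `v` that solves the backward equation inside `{0, …, N}`, the
truncated semigroup `∑ p^{N+1}_{t-s}(x, y) v_s(y)` changes only through the exit from `N`. -/
theorem hasDerivAt_duhamel {v : ℝ → ℕ → ℝ} {v' : ℕ → ℝ} {s : ℝ} (t : ℝ) {x : ℕ} (hx : x ≤ N)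
    (hv : ∀ y ≤ N, HasDerivAt (fun s => v s y) (v' y) s) :
    HasDerivAt (fun s => ∑ y ∈ Finset.range (N + 1), truncatedDensity lam mu (N + 1) (t - s) x y *
        v s y)
      ((∑ y ∈ Finset.range (N + 1), truncatedDensity lam mu (N + 1) (t - s) x y *
        (v' y - generator lam mu (v s) y)) +
        truncatedDensity lam mu (N + 1) (t - s) x N * (lam N * v s (N + 1))) s := by
  have h1 : ∀ y ∈ Finset.range (N + 1), HasDerivAt
      (fun s => truncatedDensity lam mu (N + 1) (t - s) x y * v s y)
      (-(∑ k ∈ Finset.range (N + 1), truncatedDensity lam mu (N + 1) (t - s) x k *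
        rateEntry lam mu k y) * v s y + truncatedDensity lam mu (N + 1) (t - s) x y * v' y) s := by
    intro y hy
    have hy' : y < N + 1 := Finset.mem_range.1 hy
    have h2 := (hasDerivAt_truncatedDensity_forward (lam := lam) (mu := mu)
      (show x < N + 1 by omega) hy' (t - s)).comp_const_sub t s
    exact h2.mul (hv y (by omega))
  have h2 := HasDerivAt.fun_sum h1
  refine h2.congr_deriv ?_
  have h3 : ∑ y ∈ Finset.range (N + 1), (∑ k ∈ Finset.range (N + 1),
      truncatedDensity lam mu (N + 1) (t - s) x k * rateEntry lam mu k y) * v s y =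
      ∑ k ∈ Finset.range (N + 1), truncatedDensity lam mu (N + 1) (t - s) x k *
        (generator lam mu (v s) k - if k = N then lam N * v s (N + 1) else 0) := by
    simp only [Finset.sum_mul]
    rw [Finset.sum_comm]
    refine Finset.sum_congr rfl fun k hk => ?_
    have hk' : k ≤ N := by simpa [Nat.lt_succ_iff] using hk
    rw [← sum_rateEntry_mul lam mu (v s) hk', Finset.mul_sum]
    exact Finset.sum_congr rfl fun y _ => by ring
  have h4 : ∑ k ∈ Finset.range (N + 1), truncatedDensity lam mu (N + 1) (t - s) x k *
      (if k = N then lam N * v s (N + 1) else 0) =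
      truncatedDensity lam mu (N + 1) (t - s) x N * (lam N * v s (N + 1)) := by
    simp
  rw [← h4]
  simp only [neg_mul, Finset.sum_add_distrib, Finset.sum_neg_distrib, h3]
  simp only [mul_sub, Finset.sum_sub_distrib]
  ring

end Truncated

/-! ### Lyapunov functions and the untruncated chain -/

/-- The generator does not increase the positive function `w` faster than at rate `c`. -/
structure IsLyapunov (lam mu w : ℕ → ℝ) (c : ℝ) : Prop where
  lam_nonneg : ∀ x, 0 ≤ lam x
  mu_nonneg : ∀ x, 0 ≤ mu x
  pos : ∀ x, 0 < w x
  generator_le : ∀ x, generator lam mu w x ≤ c * w x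

theorem le_of_hasDerivAt_nonneg {u u' : ℝ → ℝ} {t : ℝ} (ht : 0 ≤ t)
    (hu : ∀ s, HasDerivAt u (u' s) s) (h : ∀ s ∈ Set.Icc 0 t, 0 ≤ u' s) : u 0 ≤ u t := by
  refine monotoneOn_of_deriv_nonneg (convex_Icc 0 t)
    (fun s _ => (hu s).continuousAt.continuousWithinAt)
    (fun s _ => (hu s).differentiableAt.differentiableWithinAt) (fun s hs => ?_)
    (Set.left_mem_Icc.2 ht) (Set.right_mem_Icc.2 ht) ht
  rw [interior_Icc] at hs
  rw [(hu s).deriv]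
  exact h s (Set.Ioo_subset_Icc_self hs)

theorem sum_truncatedDensity_self {lam mu : ℕ → ℝ} {N : ℕ} (t : ℝ) {x : ℕ} (hx : x ≤ N)
    (h : ℕ → ℝ) :
    ∑ y ∈ Finset.range (N + 1), truncatedDensity lam mu (N + 1) (t - t) x y * h y = h x := by
  have hx' : x < N + 1 := by omega
  simp [truncatedDensity_zero hx', hx']

namespace IsLyapunov

variable {lam mu w : ℕ → ℝ} {c : ℝ}

theorem sum_truncatedDensity_le (hw : IsLyapunov lam mu w c) (N : ℕ) {t : ℝ} (ht : 0 ≤ t) (x : ℕ) :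
    ∑ y ∈ Finset.range (N + 1), truncatedDensity lam mu (N + 1) t x y * w y ≤
      Real.exp (c * t) * w x := by
  have hx0 := (hw.pos x).le
  rcases Nat.lt_or_ge N x with hx | hx
  · rw [Finset.sum_eq_zero fun y _ => by rw [truncatedDensity_of_le_left t hx, zero_mul]]
    positivity
  have hv : ∀ s : ℝ, ∀ y ≤ N, HasDerivAt (fun s => Real.exp (c * s) * w y)
      (Real.exp (c * s) * c * w y) s := fun s y _ => by
    have := ((hasDerivAt_id s).const_mul c).exp
    simpa using this.mul_const (w y)
  have hd := fun s => hasDerivAt_duhamel (lam := lam) (mu := mu) t hx (hv s)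
  have h := le_of_hasDerivAt_nonneg ht hd fun s hs => by
    have hp : ∀ y, 0 ≤ truncatedDensity lam mu (N + 1) (t - s) x y := fun y =>
      truncatedDensity_nonneg hw.lam_nonneg hw.mu_nonneg (sub_nonneg.2 hs.2) x y
    refine add_nonneg (Finset.sum_nonneg fun y _ => mul_nonneg (hp y) ?_)
      (mul_nonneg (hp N) (mul_nonneg (hw.lam_nonneg N)
        (mul_nonneg (Real.exp_pos _).le (hw.pos _).le)))
    have e : generator lam mu (fun y => Real.exp (c * s) * w y) y =
        Real.exp (c * s) * generator lam mu w y := by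
      unfold generator
      split_ifs <;> ring
    rw [e, mul_assoc, ← mul_sub]
    exact mul_nonneg (Real.exp_pos _).le (sub_nonneg.2 (hw.generator_le y))
  rw [sum_truncatedDensity_self t hx] at h
  simpa using h

theorem truncatedDensity_le (hw : IsLyapunov lam mu w c) (N : ℕ) {t : ℝ} (ht : 0 ≤ t) (x y : ℕ) :
    truncatedDensity lam mu N t x y ≤ Real.exp (c * t) * w x / w y := by
  have hx0 := hw.pos x
  have hy0 := hw.pos y
  rcases Nat.lt_or_ge y N with hy | hy
  · obtain ⟨M, rfl⟩ : ∃ M, N = M + 1 := ⟨N - 1, by omega⟩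
    rw [le_div_iff₀ hy0]
    refine le_trans ?_ (hw.sum_truncatedDensity_le M ht x)
    exact Finset.single_le_sum (f := fun y => truncatedDensity lam mu (M + 1) t x y * w y)
      (fun k _ => mul_nonneg (truncatedDensity_nonneg hw.lam_nonneg hw.mu_nonneg ht x k)
        (hw.pos k).le) (Finset.mem_range.2 hy)
  · rw [truncatedDensity_of_le_right t hy]
    positivity

end IsLyapunov

/-- The density of a larger truncation solves the backward equation inside the smaller one, with a
nonnegative boundary value, so that Duhamel's formula compares the two. -/
theorem truncatedDensity_mono {lam mu : ℕ → ℝ} (hlam : ∀ x, 0 ≤ lam x) (hmu : ∀ x, 0 ≤ mu x)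
    {t : ℝ} (ht : 0 ≤ t) (x y : ℕ) : Monotone fun N => truncatedDensity lam mu N t x y := by
  refine monotone_nat_of_le_succ fun M => ?_
  have hnn := @truncatedDensity_nonneg lam mu (M + 1) hlam hmu t ht x y
  by_cases hxy : x < M ∧ y < M
  swap
  · rwa [truncatedDensity, dif_neg hxy]
  obtain ⟨N, rfl⟩ : ∃ N, M = N + 1 := ⟨M - 1, by omega⟩
  have hx : x ≤ N := by omega
  have hv : ∀ s : ℝ, ∀ k ≤ N, HasDerivAt (fun s => truncatedDensity lam mu (N + 2) s k y)
      (generator lam mu (fun k => truncatedDensity lam mu (N + 2) s k y) k) s := fun s k hk =>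
    hasDerivAt_truncatedDensity_backward (by omega) y s
  have hd := fun s => hasDerivAt_duhamel (lam := lam) (mu := mu) t hx (hv s)
  have h := le_of_hasDerivAt_nonneg ht hd fun s hs => by
    simp only [sub_self, mul_zero, Finset.sum_const_zero, zero_add]
    exact mul_nonneg (truncatedDensity_nonneg hlam hmu (sub_nonneg.2 hs.2) _ _)
      (mul_nonneg (hlam N) (truncatedDensity_nonneg hlam hmu hs.1 _ _))
  rw [sum_truncatedDensity_self t hx] at h
  refine le_trans (le_of_eq ?_) h
  rw [Finset.sum_eq_single y]
  · rw [truncatedDensity_zero (by omega), if_pos rfl, mul_one, sub_zero]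
  · intro k hk hky
    rw [truncatedDensity_zero (by have := Finset.mem_range.1 hk; omega), if_neg hky, mul_zero]
  · intro hy
    exact absurd (Finset.mem_range.2 hxy.2) hy

namespace IsLyapunov

variable {lam mu w : ℕ → ℝ} {c : ℝ}

theorem tendsto_truncatedDensity (hw : IsLyapunov lam mu w c) {t : ℝ} (ht : 0 ≤ t) (x y : ℕ) :
    Filter.Tendsto (fun N => truncatedDensity lam mu N t x y) Filter.atTop
      (nhds (transitionDensity lam mu t x y)) :=
  tendsto_atTop_ciSup (truncatedDensity_mono hw.lam_nonneg hw.mu_nonneg ht x y)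
    ⟨_, Set.forall_mem_range.2 fun N => hw.truncatedDensity_le N ht x y⟩

theorem truncatedDensity_le_transitionDensity (hw : IsLyapunov lam mu w c) {t : ℝ} (ht : 0 ≤ t)
    (N x y : ℕ) : truncatedDensity lam mu N t x y ≤ transitionDensity lam mu t x y :=
  le_ciSup (f := fun N => truncatedDensity lam mu N t x y)
    ⟨_, Set.forall_mem_range.2 fun N => hw.truncatedDensity_le N ht x y⟩ N

theorem transitionDensity_nonneg (hw : IsLyapunov lam mu w c) {t : ℝ} (ht : 0 ≤ t) (x y : ℕ) :
    0 ≤ transitionDensity lam mu t x y :=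
  (truncatedDensity_nonneg hw.lam_nonneg hw.mu_nonneg ht x y).trans
    (hw.truncatedDensity_le_transitionDensity ht 0 x y)

theorem summable_transitionDensity_mul (hw : IsLyapunov lam mu w c) {t : ℝ} (ht : 0 ≤ t) (x : ℕ) :
    Summable fun y => transitionDensity lam mu t x y * w y := by
  refine summable_of_sum_range_le (c := Real.exp (c * t) * w x)
    (fun y => mul_nonneg (hw.transitionDensity_nonneg ht x y) (hw.pos y).le) fun M => ?_
  have hlim : Filter.Tendsto (fun N => ∑ y ∈ Finset.range M,
      truncatedDensity lam mu (N + 1) t x y * w y) Filter.atTop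
      (nhds (∑ y ∈ Finset.range M, transitionDensity lam mu t x y * w y)) :=
    tendsto_finsetSum _ fun y _ =>
      (((hw.tendsto_truncatedDensity ht x y).comp (Filter.tendsto_add_atTop_nat 1))).mul_const _
  refine le_of_tendsto hlim (Filter.eventually_atTop.2 ⟨M, fun N hN => ?_⟩)
  refine le_trans (Finset.sum_le_sum_of_subset_of_nonneg (Finset.range_mono (by omega)) ?_)
    (hw.sum_truncatedDensity_le N ht x)
  exact fun y _ _ => mul_nonneg (truncatedDensity_nonneg hw.lam_nonneg hw.mu_nonneg ht x y)
    (hw.pos y).le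

theorem summable_abs_transitionDensity_mul (hw : IsLyapunov lam mu w c) {t : ℝ} (ht : 0 ≤ t)
    (x : ℕ) {h : ℕ → ℝ} {C : ℝ} (hC : ∀ y, |h y| ≤ C * w y) :
    Summable fun y => |transitionDensity lam mu t x y * h y| := by
  refine Summable.of_nonneg_of_le (fun y => abs_nonneg _) (fun y => ?_)
    ((hw.summable_transitionDensity_mul ht x).mul_left C)
  have hp := hw.transitionDensity_nonneg ht x y
  rw [abs_mul, abs_of_nonneg hp]
  calc _ ≤ transitionDensity lam mu t x y * (C * w y) := mul_le_mul_of_nonneg_left (hC y) hp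
    _ = _ := by ring

theorem tendsto_sum_truncatedDensity (hw : IsLyapunov lam mu w c) {t : ℝ} (ht : 0 ≤ t)
    (x : ℕ) {h : ℕ → ℝ} {C : ℝ} (hC : ∀ y, |h y| ≤ C * w y) :
    Filter.Tendsto (fun N => ∑ y ∈ Finset.range (N + 1),
      truncatedDensity lam mu (N + 1) t x y * h y) Filter.atTop
      (nhds (∑' y, transitionDensity lam mu t x y * h y)) := by
  have h1 : ∀ N, ∑ y ∈ Finset.range (N + 1), truncatedDensity lam mu (N + 1) t x y * h y =
      ∑' y, truncatedDensity lam mu (N + 1) t x y * h y := fun N => by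
    refine (tsum_eq_sum fun y hy => ?_).symm
    rw [truncatedDensity_of_le_right t (by simpa using hy), zero_mul]
  simp only [h1]
  refine tendsto_tsum_of_dominated_convergence
    (hw.summable_abs_transitionDensity_mul ht x hC)
    (fun y => ((hw.tendsto_truncatedDensity ht x y).comp
      (Filter.tendsto_add_atTop_nat 1)).mul_const _)
    (Filter.Eventually.of_forall fun N y => ?_)
  rw [Real.norm_eq_abs, abs_mul, abs_mul]
  refine mul_le_mul_of_nonneg_right ?_ (abs_nonneg _)
  rw [abs_of_nonneg (truncatedDensity_nonneg hw.lam_nonneg hw.mu_nonneg ht x y),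
    abs_of_nonneg (hw.transitionDensity_nonneg ht x y)]
  exact hw.truncatedDensity_le_transitionDensity ht _ x y

/-- Uniqueness for the backward equation: solutions inside `{0, …, N}` whose value at `N + 1` is
small compared with a Lyapunov function are, in the limit, given by the semigroup of the chain. -/
theorem tendsto_sum_truncatedDensity_sub (hw : IsLyapunov lam mu w c) {t : ℝ} (ht : 0 ≤ t)
    (x : ℕ) {v : ℕ → ℝ → ℕ → ℝ} {B : ℕ → ℝ}
    (hv : ∀ N s, ∀ y ≤ N, HasDerivAt (fun s => v N s y) (generator lam mu (v N s) y) s)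
    (hB : ∀ N, ∀ s ∈ Set.Icc 0 t, |v N s (N + 1)| ≤ B N)
    (hlittle : (fun N => lam N * B N) =o[Filter.atTop] w) :
    Filter.Tendsto (fun N => v N t x - ∑ y ∈ Finset.range (N + 1),
      truncatedDensity lam mu (N + 1) t x y * v N 0 y) Filter.atTop (nhds 0) := by
  have h0 := (hlittle.tendsto_div_nhds_zero.const_mul (Real.exp (|c| * t) * w x)).mul_const t
  rw [mul_zero, zero_mul] at h0
  refine squeeze_zero_norm' (Filter.eventually_atTop.2 ⟨x, fun N hx => ?_⟩) h0
  have hd := fun s => hasDerivAt_duhamel (lam := lam) (mu := mu) t hx (hv N s)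
  simp only [sub_self, mul_zero, Finset.sum_const_zero, zero_add] at hd
  have hmv := (convex_Icc (0 : ℝ) t).norm_image_sub_le_of_norm_hasDerivWithin_le
    (C := Real.exp (|c| * t) * w x * (lam N * B N / w N))
    (fun s _ => (hd s).hasDerivWithinAt) (fun s hs => ?_)
    (Set.left_mem_Icc.2 ht) (Set.right_mem_Icc.2 ht)
  · rw [sum_truncatedDensity_self t hx, sub_zero, Real.norm_of_nonneg ht] at hmv
    exact hmv
  · have hts : 0 ≤ t - s := sub_nonneg.2 hs.2
    have hp := truncatedDensity_nonneg (N := N + 1) hw.lam_nonneg hw.mu_nonneg hts x N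
    have hwx := hw.pos x
    have hwN := hw.pos N
    rw [Real.norm_eq_abs, abs_mul, abs_mul, abs_of_nonneg hp, abs_of_nonneg (hw.lam_nonneg N)]
    have h1 : Real.exp (c * (t - s)) ≤ Real.exp (|c| * t) := by
      refine Real.exp_le_exp.2 ?_
      calc c * (t - s) ≤ |c| * (t - s) := mul_le_mul_of_nonneg_right (le_abs_self c) hts
        _ ≤ |c| * t := mul_le_mul_of_nonneg_left (by linarith [hs.1]) (abs_nonneg c)
    have h2 : truncatedDensity lam mu (N + 1) (t - s) x N ≤ Real.exp (|c| * t) * w x / w N :=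
      (hw.truncatedDensity_le (N + 1) hts x N).trans (by gcongr)
    calc _ ≤ (Real.exp (|c| * t) * w x / w N) * (lam N * B N) :=
          mul_le_mul h2 (mul_le_mul_of_nonneg_left (hB N s hs) (hw.lam_nonneg N))
            (mul_nonneg (hw.lam_nonneg N) (abs_nonneg _)) (by positivity)
      _ = _ := by ring

end IsLyapunov

/-! ### Chains acting triangularly on a sequence of functions -/

/-- The generator of the chain maps each `b j` of a sequence of nonnegative functions into the span
of `b j` and `b (j - 1)`, and the sequence grows fast enough to control the exit to infinity. -/
structure TriangularChain (lam mu : ℕ → ℝ) (b : ℕ → ℕ → ℝ) (c d : ℕ → ℝ) : Prop where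
  lam_nonneg : ∀ x, 0 ≤ lam x
  mu_nonneg : ∀ x, 0 ≤ mu x
  nonneg : ∀ j x, 0 ≤ b j x
  pos : ∀ x, 0 < b 0 x
  generator_zero : ∀ x, generator lam mu (b 0) x = c 0 * b 0 x
  generator_succ : ∀ j x,
    generator lam mu (b (j + 1)) x = c (j + 1) * b (j + 1) x + d j * b j x
  growth : ∀ j, ∃ K, (fun N => lam N * b j (N + 1)) =o[Filter.atTop] b K

theorem generator_sum {ι : Type*} (lam mu : ℕ → ℝ) (s : Finset ι) (e : ι → ℝ) (b : ι → ℕ → ℝ)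
    (x : ℕ) : generator lam mu (fun x => ∑ i ∈ s, b i x * e i) x =
      ∑ i ∈ s, generator lam mu (b i) x * e i := by
  unfold generator
  split_ifs
  · simp only [Finset.mul_sum, ← Finset.sum_sub_distrib]
    rw [sub_zero, Finset.mul_sum, ← Finset.sum_sub_distrib]
    exact Finset.sum_congr rfl fun i _ => by ring
  · simp only [Finset.mul_sum, ← Finset.sum_sub_distrib]
    exact Finset.sum_congr rfl fun i _ => by ring

/-- The matrix of the generator on the span of the first `n` functions of a triangular chain. -/
def triangularMatrix (c d : ℕ → ℝ) (n : ℕ) : Matrix (Fin n) (Fin n) ℝ :=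
  Matrix.of fun i j => if i = j then c j else if (i : ℕ) + 1 = j then d i else 0

/-- The instance of `det exp = exp trace` for the triangular matrix of the generator. -/
theorem det_exp_triangularMatrix (c d : ℕ → ℝ) (n : ℕ) (t : ℝ) :
    Matrix.det (NormedSpace.exp (t • triangularMatrix c d n)) =
      Real.exp ((∑ i ∈ Finset.range n, c i) * t) := by
  set M := triangularMatrix c d n with hM
  have hMij : ∀ i j : Fin n, j < i → M i j = 0 := fun i j hij => by
    have h1 : i ≠ j := hij.ne'
    have h2 : (i : ℕ) + 1 ≠ j := by rw [Fin.lt_def] at hij; omega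
    simp [hM, triangularMatrix, h1, h2]
  have hM_tri : M.BlockTriangular id := fun i j hij => hMij i j hij
  have htri : ∀ s : ℝ, (NormedSpace.exp (s • M)).BlockTriangular id := fun s =>
    Matrix.BlockTriangular.exp fun i j hij => by
      rw [Matrix.smul_apply, hMij i j hij, smul_zero]
  have hdiag : ∀ i, NormedSpace.exp (t • M) i i = Real.exp (c i * t) := by
    intro i
    -- The diagonal entry solves `E' = c i * E`, `E 0 = 1`.
    have hE : ∀ s : ℝ, HasDerivAt (fun s : ℝ => NormedSpace.exp (s • M) i i)
        (NormedSpace.exp (s • M) i i * c i) s := fun s => by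
      refine (hasDerivAt_exp_smul_apply M s i i).congr_deriv ?_
      rw [Matrix.mul_apply, Finset.sum_eq_single i]
      · simp [hM, triangularMatrix]
      · intro k _ hk
        rcases lt_or_gt_of_ne hk with h | h
        · rw [htri s (show id k < id i from h), zero_mul]
        · rw [hMij k i h, mul_zero]
      · simp
    have hprod : ∀ s : ℝ, HasDerivAt
        (fun s : ℝ => NormedSpace.exp (s • M) i i * Real.exp (-(c i * s))) 0 s := fun s => by
      have h2 : HasDerivAt (fun s => Real.exp (-(c i * s)))
          (Real.exp (-(c i * s)) * (-(c i * 1))) s :=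
        (((hasDerivAt_id s).const_mul (c i)).neg).exp
      exact ((hE s).mul h2).congr_deriv (by ring)
    have hconst := is_const_of_deriv_eq_zero (fun s => (hprod s).differentiableAt)
      (fun s => (hprod s).deriv) t 0
    simp only [zero_smul, NormedSpace.exp_zero, Matrix.one_apply_eq, mul_zero, neg_zero,
      Real.exp_zero, mul_one, Real.exp_neg] at hconst
    field_simp at hconst
    exact hconst
  rw [Matrix.det_of_isUpperTriangular (htri t), Finset.sum_range, Finset.sum_mul, Real.exp_sum]
  exact Finset.prod_congr rfl fun i _ => hdiag i

namespace TriangularChain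

variable {lam mu : ℕ → ℝ} {b : ℕ → ℕ → ℝ} {c d : ℕ → ℝ}

/-- The sum of the first `K + 1` functions, a Lyapunov function of the chain. -/
def weight (b : ℕ → ℕ → ℝ) (K x : ℕ) : ℝ := ∑ j ∈ Finset.range (K + 1), b j x

theorem le_weight (H : TriangularChain lam mu b c d) {j K : ℕ} (hj : j ≤ K) (x : ℕ) :
    b j x ≤ weight b K x :=
  Finset.single_le_sum (f := fun j => b j x) (fun j _ => H.nonneg j x)
    (Finset.mem_range.2 (by omega))

theorem weight_pos (H : TriangularChain lam mu b c d) (K x : ℕ) : 0 < weight b K x :=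
  (H.pos x).trans_le (H.le_weight (Nat.zero_le K) x)

theorem weight_mono (H : TriangularChain lam mu b c d) {J K : ℕ} (h : J ≤ K) (x : ℕ) :
    weight b J x ≤ weight b K x :=
  Finset.sum_le_sum_of_subset_of_nonneg (Finset.range_mono (by omega)) fun j _ _ => H.nonneg j x

theorem isLyapunov_weight (H : TriangularChain lam mu b c d) (K : ℕ) :
    ∃ C, IsLyapunov lam mu (weight b K) C := by
  set e : ℕ → ℝ := fun j => |c j| + |d j|
  refine ⟨∑ j ∈ Finset.range (K + 1), e j, H.lam_nonneg, H.mu_nonneg, H.weight_pos K, fun x => ?_⟩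
  have h1 : ∀ j ∈ Finset.range (K + 1), e j ≤ ∑ j ∈ Finset.range (K + 1), e j := fun j hj =>
    Finset.single_le_sum (f := e) (fun j _ => by positivity) hj
  have h2 : generator lam mu (weight b K) x =
      ∑ j ∈ Finset.range (K + 1), generator lam mu (b j) x := by
    have := generator_sum lam mu (Finset.range (K + 1)) (fun _ => 1) b x
    simp only [mul_one] at this
    exact this
  have h3 : ∑ j ∈ Finset.range (K + 1), generator lam mu (b j) x =
      ∑ j ∈ Finset.range (K + 1), c j * b j x + ∑ j ∈ Finset.range K, d j * b j x := by
    rw [Finset.sum_range_succ', Finset.sum_range_succ' (fun j => c j * b j x), H.generator_zero]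
    simp only [H.generator_succ, Finset.sum_add_distrib]
    ring
  have h4 : ∑ j ∈ Finset.range K, d j * b j x ≤ ∑ j ∈ Finset.range (K + 1), |d j| * b j x := by
    refine le_trans (Finset.sum_le_sum fun j _ =>
      mul_le_mul_of_nonneg_right (le_abs_self (d j)) (H.nonneg j x)) ?_
    exact Finset.sum_le_sum_of_subset_of_nonneg (Finset.range_mono (by omega)) fun j _ _ =>
      mul_nonneg (abs_nonneg _) (H.nonneg j x)
  have h5 : ∑ j ∈ Finset.range (K + 1), c j * b j x ≤ ∑ j ∈ Finset.range (K + 1), |c j| * b j x :=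
    Finset.sum_le_sum fun j _ => mul_le_mul_of_nonneg_right (le_abs_self (c j)) (H.nonneg j x)
  rw [h2, h3]
  calc _ ≤ ∑ j ∈ Finset.range (K + 1), e j * b j x := by
        simp only [e, add_mul, Finset.sum_add_distrib]
        exact add_le_add h5 h4
    _ ≤ ∑ j ∈ Finset.range (K + 1), (∑ j ∈ Finset.range (K + 1), e j) * b j x :=
        Finset.sum_le_sum fun j hj => mul_le_mul_of_nonneg_right (h1 j hj) (H.nonneg j x)
    _ = _ := by rw [← Finset.mul_sum]; rfl

theorem growth_weight (H : TriangularChain lam mu b c d) (J : ℕ) :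
    ∃ K, J ≤ K ∧ (fun N => lam N * weight b J (N + 1)) =o[Filter.atTop] weight b K := by
  choose K hK using H.growth
  set K' := J + ∑ j ∈ Finset.range (J + 1), K j with hK'
  refine ⟨K', by omega, ?_⟩
  simp only [weight, Finset.mul_sum]
  refine Asymptotics.IsLittleO.fun_sum fun j hj => (hK j).trans_isBigO ?_
  have hle : K j ≤ K' := by
    have := Finset.single_le_sum (f := K) (fun j _ => Nat.zero_le _) hj
    omega
  refine Asymptotics.isBigO_of_le _ fun N => ?_
  rw [Real.norm_of_nonneg (H.nonneg _ _), Real.norm_of_nonneg]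
  · exact H.le_weight hle N
  · exact (H.weight_pos K' N).le

/-- A solution of the backward equation that is dominated by finitely many of the `b j`, locally
uniformly in time, is given by the semigroup. -/
theorem hasSum_of_backward (H : TriangularChain lam mu b c d) {v : ℝ → ℕ → ℝ} {t : ℝ}
    (ht : 0 ≤ t) (hv : ∀ s y, HasDerivAt (fun s => v s y) (generator lam mu (v s) y) s)
    (J : ℕ) (C : ℝ) (hC : ∀ s ∈ Set.Icc 0 t, ∀ y, |v s y| ≤ C * weight b J y) (x : ℕ) :
    (Summable fun y => |transitionDensity lam mu t x y * v 0 y|) ∧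
      HasSum (fun y => transitionDensity lam mu t x y * v 0 y) (v t x) := by
  obtain ⟨K, hJK, hK⟩ := H.growth_weight J
  obtain ⟨c', hw⟩ := H.isLyapunov_weight K
  have hC0 : 0 ≤ C := by
    have h := (abs_nonneg _).trans (hC 0 (Set.left_mem_Icc.2 ht) 0)
    by_contra hneg
    have := H.weight_pos J 0
    nlinarith
  have hdom : ∀ y, |v 0 y| ≤ C * weight b K y := fun y =>
    (hC 0 (Set.left_mem_Icc.2 ht) y).trans (mul_le_mul_of_nonneg_left (H.weight_mono hJK y) hC0)
  have hs := hw.summable_abs_transitionDensity_mul ht x hdom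
  refine ⟨hs, ?_⟩
  have h1 := hw.tendsto_sum_truncatedDensity_sub ht x (v := fun _ => v)
    (B := fun N => C * weight b J (N + 1)) (fun N s y _ => hv s y)
    (fun N s hs => hC s hs (N + 1)) (by
      have := hK.const_mul_left C
      refine this.congr_left fun N => by ring)
  have h2 := hw.tendsto_sum_truncatedDensity ht x hdom
  have h3 := h1.add h2
  simp only [sub_add_cancel, zero_add] at h3
  rw [tendsto_nhds_unique tendsto_const_nhds h3]
  exact hs.of_abs.hasSum

/-- The semigroup of a triangular chain acts on the span of the first `n` functions by the exponential
of the matrix of the generator. -/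
theorem hasSum_exp (H : TriangularChain lam mu b c d) {t : ℝ} (ht : 0 ≤ t) (n : ℕ) (j : Fin n)
    (x : ℕ) :
    (Summable fun y => |transitionDensity lam mu t x y * b j y|) ∧
      HasSum (fun y => transitionDensity lam mu t x y * b j y)
        (∑ i : Fin n, b i x * NormedSpace.exp (t • triangularMatrix c d n) i j) := by
  set M := triangularMatrix c d n with hM
  set v : ℝ → ℕ → ℝ := fun s y => ∑ i : Fin n, b i y * NormedSpace.exp (s • M) i j with hv_def
  have hgen : ∀ (k : Fin n) y, generator lam mu (b k) y = ∑ i : Fin n, b i y * M i k := by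
    intro k y
    obtain ⟨k, hk⟩ := k
    cases k with
    | zero =>
      rw [Finset.sum_eq_single ⟨0, hk⟩]
      · simpa [hM, triangularMatrix, mul_comm] using H.generator_zero y
      · intro i _ hi
        simp [hM, triangularMatrix, hi]
      · simp
    | succ k =>
      have hne : (⟨k + 1, hk⟩ : Fin n) ≠ ⟨k, by omega⟩ := by simp
      rw [Finset.sum_eq_add ⟨k + 1, hk⟩ ⟨k, by omega⟩ hne]
      · have := H.generator_succ k y
        simp only [hM, triangularMatrix, Matrix.of_apply, hne.symm, if_true, if_false]
        rw [this]
        ring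
      · rintro i - ⟨h1, h2⟩
        have h3 : (i : ℕ) ≠ k := fun h => h2 (Fin.ext h)
        simp [hM, triangularMatrix, h1, h3]
      · simp
      · simp
  have hv : ∀ s y, HasDerivAt (fun s => v s y) (generator lam mu (v s) y) s := by
    intro s y
    have h1 := HasDerivAt.fun_sum (u := Finset.univ) fun (i : Fin n) _ =>
      (hasDerivAt_exp_smul_apply' M s i j).const_mul (b i y)
    refine h1.congr_deriv ?_
    rw [hv_def, generator_sum lam mu Finset.univ (fun i : Fin n => NormedSpace.exp (s • M) i j)
      (fun i : Fin n => b i) y]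
    simp only [hgen, Matrix.mul_apply, Finset.mul_sum, Finset.sum_mul]
    rw [Finset.sum_comm]
    exact Finset.sum_congr rfl fun k _ => Finset.sum_congr rfl fun i _ => by ring
  have hbd : ∀ i : Fin n, ∃ C, ∀ s ∈ Set.Icc 0 t, |NormedSpace.exp (s • M) i j| ≤ C := by
    intro i
    exact isCompact_Icc.exists_bound_of_continuousOn fun s _ =>
      (hasDerivAt_exp_smul_apply M s i j).continuousAt.continuousWithinAt
  choose C hC using hbd
  have hdom : ∀ s ∈ Set.Icc 0 t, ∀ y, |v s y| ≤ (∑ i, C i) * weight b n y := by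
    intro s hs y
    refine (Finset.abs_sum_le_sum_abs _ _).trans ?_
    rw [Finset.sum_mul]
    refine Finset.sum_le_sum fun i _ => ?_
    rw [abs_mul, abs_of_nonneg (H.nonneg _ _), mul_comm]
    exact mul_le_mul (hC i s hs) (H.le_weight i.2.le y) (H.nonneg _ _)
      ((abs_nonneg _).trans (hC i s hs))
  have := H.hasSum_of_backward ht hv n _ hdom x
  have h0 : v 0 = b j := by
    funext y
    simp [hv_def, Matrix.one_apply]
  rw [h0] at this
  exact this

theorem hasSum_zero (H : TriangularChain lam mu b c d) {t : ℝ} (ht : 0 ≤ t) (x : ℕ) :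
    HasSum (fun y => transitionDensity lam mu t x y * b 0 y) (Real.exp (c 0 * t) * b 0 x) := by
  have h := (H.hasSum_exp ht 1 0 x).2
  have h1 := det_exp_triangularMatrix c d 1 t
  rw [Matrix.det_fin_one] at h1
  simp only [Finset.univ_unique, Fin.default_eq_zero, Finset.sum_singleton, Fin.val_zero, h1,
    Finset.range_one] at h
  rwa [mul_comm] at h

/-- The determinants `det (b j (x i))` are eigenfunctions of the Karlin-McGregor semigroup. -/
theorem hasSum_kmDensity (H : TriangularChain lam mu b c d) {t : ℝ} (ht : 0 ≤ t) {n : ℕ}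
    (x : W n) :
    HasSum (fun y : W n => kmDensity lam mu t x y *
        Matrix.det (Matrix.of fun i j : Fin n => b j (y.1 i)))
      (Real.exp ((∑ i ∈ Finset.range n, c i) * t) *
        Matrix.det (Matrix.of fun i j : Fin n => b j (x.1 i))) := by
  have h := hasSum_det_mul_det (fun i y => transitionDensity lam mu t (x.1 i) y)
    (fun y (j : Fin n) => b j y) fun i k => (H.hasSum_exp ht n k (x.1 i)).1
  have e : Matrix.det (Matrix.of fun i (k : Fin n) =>
      ∑' y, transitionDensity lam mu t (x.1 i) y * b k y) =
      Real.exp ((∑ i ∈ Finset.range n, c i) * t) *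
        Matrix.det (Matrix.of fun i j : Fin n => b j (x.1 i)) := by
    rw [← det_exp_triangularMatrix c d n t, mul_comm, ← Matrix.det_mul]
    congr 1
    ext i k
    rw [Matrix.mul_apply]
    exact (H.hasSum_exp ht n k (x.1 i)).2.tsum_eq
  rw [← e]
  exact h

end TriangularChain

/-! ### Polynomials in `(x + s/2)²` -/

/-- The monic polynomial `∏_{i<j} (x-i)(x+s+i)` of degree `j` in `(x+s/2)²`. -/
def chamberPoly (s : ℝ) (j : ℕ) (x : ℝ) : ℝ := ∏ i ∈ Finset.range j, (x - i) * (x + s + i)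

/-- Differences lower the degree by one and shift the parameter: after division by the increment of
`(x+s/2)²` they are again of the form `chamberPoly`. -/
theorem chamberPoly_add_one_sub (s : ℝ) (j : ℕ) (x : ℝ) :
    chamberPoly s (j + 1) (x + 1) - chamberPoly s (j + 1) x =
      (j + 1) * (2 * x + s + 1) * chamberPoly (s + 1) j x := by
  have h1 : ∀ j : ℕ, chamberPoly s (j + 1) (x + 1) =
      (x + 1) * (x + s + j + 1) * chamberPoly (s + 1) j x := by
    intro j
    induction j with
    | zero =>
      simp only [chamberPoly, Finset.prod_range_succ, Finset.prod_range_zero]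
      push_cast
      ring
    | succ j ih =>
      rw [chamberPoly, Finset.prod_range_succ, ← chamberPoly, ih, chamberPoly, chamberPoly,
        Finset.prod_range_succ]
      push_cast
      ring
  have h2 : ∀ j : ℕ, chamberPoly s (j + 1) x =
      (x - j) * (x + s) * chamberPoly (s + 1) j x := by
    intro j
    induction j with
    | zero => simp [chamberPoly]
    | succ j ih =>
      rw [chamberPoly, Finset.prod_range_succ, ← chamberPoly, ih, chamberPoly, chamberPoly,
        Finset.prod_range_succ]
      push_cast
      ring
  rw [h1, h2]
  ring

theorem chamberPoly_succ (s : ℝ) (j : ℕ) (x : ℝ) :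
    chamberPoly s (j + 1) x = chamberPoly s j x * ((x - j) * (x + s + j)) :=
  Finset.prod_range_succ _ _

theorem add_mul_chamberPoly_add_one (s : ℝ) (j : ℕ) (x : ℝ) :
    (x + s) * chamberPoly (s + 1) j x = (x + s + j) * chamberPoly s j x := by
  induction j with
  | zero => simp [chamberPoly]
  | succ j ih =>
    rw [chamberPoly_succ, chamberPoly_succ, ← mul_assoc, ih]
    push_cast
    ring

theorem mul_chamberPoly_add_one_sub_one (s : ℝ) (j : ℕ) (x : ℝ) :
    x * chamberPoly (s + 1) j (x - 1) = (x - j) * chamberPoly s j x := by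
  induction j with
  | zero => simp [chamberPoly]
  | succ j ih =>
    rw [chamberPoly_succ, chamberPoly_succ, ← mul_assoc, ih]
    push_cast
    ring

theorem chamberPoly_succ_zero (s : ℝ) (j : ℕ) : chamberPoly s (j + 1) 0 = 0 := by
  refine Finset.prod_eq_zero (Finset.mem_range.2 (Nat.succ_pos j)) ?_
  simp

/-- At natural numbers `x < j` a factor vanishes, and for `x ≥ j` all factors are nonnegative. -/
theorem chamberPoly_nonneg {s : ℝ} (hs : -1 < s) (j x : ℕ) : 0 ≤ chamberPoly s j x := by
  rcases Nat.lt_or_ge x j with h | h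
  · refine (Finset.prod_eq_zero (Finset.mem_range.2 h) ?_).ge
    simp
  · refine Finset.prod_nonneg fun i hi => ?_
    have hi' : i + 1 ≤ x := by have := Finset.mem_range.1 hi; omega
    have hi'' : (i : ℝ) + 1 ≤ x := by exact_mod_cast hi'
    have : (0 : ℝ) ≤ i := Nat.cast_nonneg i
    exact mul_nonneg (by linarith) (by linarith)

/-! ### The rates -/

theorem birthRate_eq_mul (a b : ℝ) (u u' : ℂ) (x : ℕ) :
    birthRate a b u u' x = betaQuotient a b x *
      ((x + a + 1) * (x ^ 2 - x * (u + u').re + (u * u').re) / (2 * x + a + b + 2)) := by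
  have h : (((x : ℂ) - u) * ((x : ℂ) - u')).re = x ^ 2 - x * (u + u').re + (u * u').re := by
    simp
    ring
  rw [birthRate, h]

theorem birthRate_zero (a b : ℝ) (u u' : ℂ) :
    birthRate a b u u' 0 = (a + 1) * (u * u').re / (a + b + 2) := by
  rw [birthRate_eq_mul]
  simp [betaQuotient]

theorem birthRate_succ (a b : ℝ) (u u' : ℂ) (x : ℕ) :
    birthRate a b u u' (x + 1) = (x + a + b + 2) * (x + a + 2) *
      ((x + 1) ^ 2 - (x + 1) * (u + u').re + (u * u').re) /
        ((2 * x + a + b + 3) * (2 * x + a + b + 4)) := by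
  rw [birthRate_eq_mul, betaQuotient, if_neg (Nat.succ_ne_zero x), div_mul_div_comm]
  push_cast
  congr 1 <;> ring

theorem deathRate_zero (a b : ℝ) (u u' : ℂ) : deathRate a b u u' 0 = 0 := by
  simp [deathRate]

theorem deathRate_succ (a b : ℝ) (u u' : ℂ) (x : ℕ) :
    deathRate a b u u' (x + 1) = (x + 1) * (x + b + 1) *
      ((x + a + b + 2) ^ 2 + (x + a + b + 2) * (u + u').re + (u * u').re) /
        ((2 * x + a + b + 3) * (2 * x + a + b + 2)) := by
  have h : ((((x + 1 : ℕ) : ℂ) + u + a + b + 1) * (((x + 1 : ℕ) : ℂ) + u' + a + b + 1)).re =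
      (x + a + b + 2) ^ 2 + (x + a + b + 2) * (u + u').re + (u * u').re := by
    simp
    ring
  rw [deathRate, h]
  push_cast
  congr 1 <;> ring

/-- The eigenvalue of the generator on `chamberPoly (a + b + 1) j`, modulo lower degree. -/
def diagCoeff (b : ℝ) (u u' : ℂ) (j : ℕ) : ℝ := j * (j - 1 - b - (u + u').re)

/-- The coefficient of `chamberPoly (a + b + 1) j` in the image of
`chamberPoly (a + b + 1) (j + 1)` under the generator. -/
def lowerCoeff (a : ℝ) (u u' : ℂ) (j : ℕ) : ℝ :=
  (j + 1) * (j + 1 + a) * (j ^ 2 - j * (u + u').re + (u * u').re)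

theorem sum_diagCoeff (b : ℝ) (u u' : ℂ) (n : ℕ) :
    ∑ i ∈ Finset.range n, diagCoeff b u u' i = eigenExponent b u u' n := by
  induction n with
  | zero => simp [eigenExponent]
  | succ n ih =>
    rw [Finset.sum_range_succ, ih]
    simp only [eigenExponent, diagCoeff]
    push_cast
    ring

section

variable {a b : ℝ}

theorem generator_chamberPoly_succ (ha : -1 < a) (hb : -1 < b) (u u' : ℂ) (j x : ℕ) :
    generator (birthRate a b u u') (deathRate a b u u')
        (fun x => chamberPoly (a + b + 1) (j + 1) x) x =
      diagCoeff b u u' (j + 1) * chamberPoly (a + b + 1) (j + 1) x +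
        lowerCoeff a u u' j * chamberPoly (a + b + 1) j x := by
  cases x with
  | zero =>
    have h := chamberPoly_add_one_sub (a + b + 1) j 0
    simp only [generator, deathRate_zero, birthRate_zero, Nat.cast_zero, zero_mul, sub_zero,
      Nat.cast_add, Nat.cast_one]
    rw [h, chamberPoly_succ_zero]
    cases j with
    | zero =>
      have : a + b + 2 ≠ 0 := by linarith
      simp [chamberPoly, lowerCoeff]
      field_simp
      ring
    | succ j => simp [chamberPoly_succ_zero]
  | succ x =>
    have h1 := chamberPoly_add_one_sub (a + b + 1) j (x + 1)
    have h2 := chamberPoly_add_one_sub (a + b + 1) j x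
    have h3 := add_mul_chamberPoly_add_one (a + b + 1) j (x + 1)
    have h4 := mul_chamberPoly_add_one_sub_one (a + b + 1) j (x + 1)
    rw [add_sub_cancel_right] at h4
    have hx : (0 : ℝ) ≤ x := Nat.cast_nonneg x
    have p1 : (2 * (x : ℝ) + a + b + 3) ≠ 0 := by linarith
    have p2 : (2 * (x : ℝ) + a + b + 2) ≠ 0 := by linarith
    have p3 : (2 * (x : ℝ) + a + b + 4) ≠ 0 := by linarith
    simp only [generator, Nat.succ_ne_zero, if_false, Nat.add_sub_cancel, birthRate_succ,
      deathRate_succ, diagCoeff, lowerCoeff]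
    push_cast
    rw [h1, h2, chamberPoly_succ]
    set q := chamberPoly (a + b + 1) j (x + 1)
    set r1 := chamberPoly (a + b + 1 + 1) j (x + 1)
    set r0 := chamberPoly (a + b + 1 + 1) j x
    set v := (u + u').re
    set m := (u * u').re
    have e1 : ∀ A B : ℝ, A = B * (2 * (x : ℝ) + a + b + 3) →
        A / (2 * (x : ℝ) + a + b + 3) = B := fun A B h => by rw [h, mul_div_cancel_right₀ _ p1]
    refine Eq.trans ?_ (e1 ((j + 1) * (((x : ℝ) + a + 2) * ((x + 1) ^ 2 - (x + 1) * v + m) *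
        ((x + 1 + (a + b + 1)) * r1) - (x + b + 1) *
        ((x + a + b + 2) ^ 2 + (x + a + b + 2) * v + m) * ((x + 1) * r0))) _ ?_)
    · have e2 : ∀ A B P p : ℝ, P = p → p ≠ 0 →
          A / ((2 * (x : ℝ) + a + b + 3) * p) * ((j + 1) * P * B) =
            A * ((j + 1) * B) / (2 * (x : ℝ) + a + b + 3) := by
        rintro A B P p rfl hp
        rw [div_mul_eq_mul_div, div_eq_div_iff (mul_ne_zero p1 hp) p1]
        ring
      rw [e2 _ r1 _ _ (by ring) p3, e2 _ r0 _ _ (by ring) p2, ← sub_div]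
      congr 1
      ring
    · rw [h3, h4]
      ring

end

/-! ### The weights -/

/-- `Γ(z+a+b+2) Γ(z+a+2) / ((a+1) z! Γ(z+b+1))`, the value of `∑_{y ≤ z} g(y)`. -/
def cumWeight (a b : ℝ) (z : ℕ) : ℝ :=
  Real.Gamma (z + a + b + 2) * Real.Gamma (z + a + 2) /
    ((a + 1) * (z.factorial : ℝ) * Real.Gamma (z + b + 1))

section

variable {a b : ℝ}

theorem cumWeight_pos (ha : -1 < a) (hb : -1 < b) (z : ℕ) : 0 < cumWeight a b z := by
  have hz : (0 : ℝ) ≤ z := Nat.cast_nonneg z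
  have h1 : 0 < Real.Gamma (z + a + b + 2) := Real.Gamma_pos_of_pos (by linarith)
  have h2 : 0 < Real.Gamma (z + a + 2) := Real.Gamma_pos_of_pos (by linarith)
  have h3 : 0 < Real.Gamma (z + b + 1) := Real.Gamma_pos_of_pos (by linarith)
  have h4 : 0 < a + 1 := by linarith
  have h5 : (0 : ℝ) < z.factorial := by exact_mod_cast z.factorial_pos
  unfold cumWeight
  positivity

theorem cumWeight_succ (ha : -1 < a) (hb : -1 < b) (z : ℕ) :
    cumWeight a b (z + 1) =
      cumWeight a b z * ((z + a + b + 2) * (z + a + 2)) / ((z + 1) * (z + b + 1)) := by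
  have hz : (0 : ℝ) ≤ z := Nat.cast_nonneg z
  have h3 : Real.Gamma (z + b + 1) ≠ 0 := (Real.Gamma_pos_of_pos (by linarith)).ne'
  have h4 : a + 1 ≠ 0 := by linarith
  have h5 : (z.factorial : ℝ) ≠ 0 := by exact_mod_cast z.factorial_ne_zero
  have h6 : (z : ℝ) + b + 1 ≠ 0 := by linarith
  have h7 : (z : ℝ) + 1 ≠ 0 := by linarith
  have g1 : Real.Gamma (((z + 1 : ℕ) : ℝ) + a + b + 2) =
      (z + a + b + 2) * Real.Gamma (z + a + b + 2) := by
    rw [← Real.Gamma_add_one (by linarith)]; push_cast; congr 1; ring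
  have g2 : Real.Gamma (((z + 1 : ℕ) : ℝ) + a + 2) = (z + a + 2) * Real.Gamma (z + a + 2) := by
    rw [← Real.Gamma_add_one (by linarith)]; push_cast; congr 1; ring
  have g3 : Real.Gamma (((z + 1 : ℕ) : ℝ) + b + 1) = (z + b + 1) * Real.Gamma (z + b + 1) := by
    rw [← Real.Gamma_add_one (by linarith)]; push_cast; congr 1; ring
  rw [cumWeight, cumWeight, g1, g2, g3, Nat.factorial_succ]
  push_cast
  field_simp

theorem gWeight_zero (ha : -1 < a) : gWeight a b 0 = cumWeight a b 0 := by
  have h4 : a + 1 ≠ 0 := by linarith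
  have g2 : Real.Gamma (a + 2) = (a + 1) * Real.Gamma (a + 1) := by
    rw [← Real.Gamma_add_one (by linarith)]; congr 1; ring
  simp only [gWeight, gammaFactor, cumWeight, if_true, Nat.cast_zero, zero_add, g2,
    Nat.factorial_zero, Nat.cast_one, mul_one, one_mul]
  field_simp

theorem gWeight_succ (ha : -1 < a) (hb : -1 < b) (z : ℕ) :
    gWeight a b (z + 1) =
      cumWeight a b z * ((a + 1) * (2 * z + a + b + 3)) / ((z + 1) * (z + b + 1)) := by
  have hz : (0 : ℝ) ≤ z := Nat.cast_nonneg z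
  have h3 : Real.Gamma (z + b + 1) ≠ 0 := (Real.Gamma_pos_of_pos (by linarith)).ne'
  have h4 : a + 1 ≠ 0 := by linarith
  have h5 : (z.factorial : ℝ) ≠ 0 := by exact_mod_cast z.factorial_ne_zero
  have h6 : (z : ℝ) + b + 1 ≠ 0 := by linarith
  have h7 : (z : ℝ) + 1 ≠ 0 := by linarith
  have g1 : Real.Gamma (((z + 1 : ℕ) : ℝ) + a + b + 1) = Real.Gamma (z + a + b + 2) := by
    push_cast; congr 1; ring
  have g2 : Real.Gamma (((z + 1 : ℕ) : ℝ) + a + 1) = Real.Gamma (z + a + 2) := by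
    push_cast; congr 1; ring
  have g3 : Real.Gamma (((z + 1 : ℕ) : ℝ) + b + 1) = (z + b + 1) * Real.Gamma (z + b + 1) := by
    rw [← Real.Gamma_add_one (by linarith)]; push_cast; congr 1; ring
  rw [gWeight, gammaFactor, if_neg (Nat.succ_ne_zero z), cumWeight, g1, g2, g3,
    Nat.factorial_succ]
  push_cast
  field_simp
  ring

theorem gWeight_pos (ha : -1 < a) (hb : -1 < b) (y : ℕ) : 0 < gWeight a b y := by
  cases y with
  | zero => rw [gWeight_zero ha]; exact cumWeight_pos ha hb 0
  | succ z =>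
    rw [gWeight_succ ha hb]
    have hz : (0 : ℝ) ≤ z := Nat.cast_nonneg z
    have := cumWeight_pos ha hb z
    have h1 : 0 < a + 1 := by linarith
    have h2 : 0 < 2 * (z : ℝ) + a + b + 3 := by linarith
    have h3 : 0 < (z : ℝ) + b + 1 := by linarith
    positivity

theorem fWeight_eq (ha : -1 < a) (z : ℕ) :
    fWeight a b z = (2 * z + a + b + 2) / ((a + 1) * cumWeight a b z) := by
  have h4 : a + 1 ≠ 0 := by linarith
  rw [fWeight, cumWeight]
  rw [mul_div_assoc', mul_assoc (a + 1), mul_div_mul_left _ _ h4, div_div_eq_mul_div, mul_assoc]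

theorem fWeight_pos (ha : -1 < a) (hb : -1 < b) (z : ℕ) : 0 < fWeight a b z := by
  rw [fWeight_eq ha]
  have hz : (0 : ℝ) ≤ z := Nat.cast_nonneg z
  have := cumWeight_pos ha hb z
  have h1 : 0 < a + 1 := by linarith
  have h2 : 0 < 2 * (z : ℝ) + a + b + 2 := by linarith
  positivity

/-- The flow of the measure `g` from `z` to `z + 1`. -/
theorem gWeight_mul_birthRate (ha : -1 < a) (hb : -1 < b) (u u' : ℂ) (z : ℕ) :
    gWeight a b z * birthRate a b u u' z =
      cumWeight a b z * (a + 1) * (z ^ 2 - z * (u + u').re + (u * u').re) /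
        (2 * z + a + b + 2) := by
  cases z with
  | zero =>
    rw [gWeight_zero ha, birthRate_zero]
    simp
    ring
  | succ z =>
    have hz : (0 : ℝ) ≤ z := Nat.cast_nonneg z
    have h2 : 2 * (z : ℝ) + a + b + 3 ≠ 0 := by linarith
    have h3 : (z : ℝ) + b + 1 ≠ 0 := by linarith
    have h5 : 2 * (z : ℝ) + a + b + 4 ≠ 0 := by linarith
    have h6 : (z : ℝ) + 1 ≠ 0 := by linarith
    rw [gWeight_succ ha hb, birthRate_succ, cumWeight_succ ha hb]
    push_cast
    rw [show 2 * ((z : ℝ) + 1) + a + b + 2 = 2 * z + a + b + 4 by ring]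
    field_simp

/-- The flow of the measure `g` from `z + 1` to `z`. -/
theorem gWeight_mul_deathRate (ha : -1 < a) (hb : -1 < b) (u u' : ℂ) (z : ℕ) :
    gWeight a b (z + 1) * deathRate a b u u' (z + 1) =
      cumWeight a b z * (a + 1) *
        ((z + a + b + 2) ^ 2 + (z + a + b + 2) * (u + u').re + (u * u').re) /
        (2 * z + a + b + 2) := by
  have hz : (0 : ℝ) ≤ z := Nat.cast_nonneg z
  have h2 : 2 * (z : ℝ) + a + b + 3 ≠ 0 := by linarith
  have h3 : (z : ℝ) + b + 1 ≠ 0 := by linarith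
  have h5 : 2 * (z : ℝ) + a + b + 2 ≠ 0 := by linarith
  have h6 : (z : ℝ) + 1 ≠ 0 := by linarith
  rw [gWeight_succ ha hb, deathRate_succ]
  field_simp

/-- The eigenvalue of the measure `g` under the adjoint of the generator. -/
def gEigenvalue (a b : ℝ) (u u' : ℂ) : ℝ := (a + 1) * (a + b + 2 + (u + u').re)

theorem gWeight_eigenmeasure_zero (ha : -1 < a) (hb : -1 < b) (u u' : ℂ) :
    gWeight a b 1 * deathRate a b u u' 1 =
      gWeight a b 0 * (birthRate a b u u' 0 + gEigenvalue a b u u') := by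
  have h := gWeight_mul_deathRate ha hb u u' 0
  have h' := gWeight_mul_birthRate ha hb u u' 0
  have h5 : a + b + 2 ≠ 0 := by linarith
  rw [zero_add] at h
  rw [mul_add, h, h', gWeight_zero ha, gEigenvalue]
  simp only [Nat.cast_zero, mul_zero, zero_add]
  field_simp
  ring

theorem gWeight_eigenmeasure_succ (ha : -1 < a) (hb : -1 < b) (u u' : ℂ) (z : ℕ) :
    gWeight a b z * birthRate a b u u' z +
        gWeight a b (z + 2) * deathRate a b u u' (z + 2) =
      gWeight a b (z + 1) * (birthRate a b u u' (z + 1) + deathRate a b u u' (z + 1) +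
        gEigenvalue a b u u') := by
  have hz : (0 : ℝ) ≤ z := Nat.cast_nonneg z
  have h1 : (z : ℝ) * 2 + a + b + 2 ≠ 0 := by linarith
  have h2 : (z : ℝ) * 2 + a + b + 4 ≠ 0 := by linarith
  have h3 : (z : ℝ) + b + 1 ≠ 0 := by linarith
  have h4 : (z : ℝ) + 1 ≠ 0 := by linarith
  have e1 := gWeight_mul_birthRate ha hb u u' z
  have e2 := gWeight_mul_deathRate ha hb u u' (z + 1)
  have e3 := gWeight_mul_birthRate ha hb u u' (z + 1)
  have e4 := gWeight_mul_deathRate ha hb u u' z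
  rw [mul_add, mul_add, e1, e2, e3, e4, cumWeight_succ ha hb, gWeight_succ ha hb, gEigenvalue]
  push_cast
  rw [show 2 * ((z : ℝ) + 1) + a + b + 2 = 2 * z + a + b + 4 by ring]
  field_simp
  ring

/-! ### The hidden chain and the weight `g` -/

/-- `∑_{y ≤ z} g(y) h(y)`. -/
def cumSum (a b : ℝ) (h : ℕ → ℝ) (z : ℕ) : ℝ :=
  ∑ y ∈ Finset.range (z + 1), gWeight a b y * h y

theorem cumSum_succ (h : ℕ → ℝ) (z : ℕ) :
    cumSum a b h (z + 1) = cumSum a b h z + gWeight a b (z + 1) * h (z + 1) :=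
  Finset.sum_range_succ _ _

theorem hiddenBirthRate_mul (ha : -1 < a) (hb : -1 < b) (u u' : ℂ) (z : ℕ) :
    hiddenBirthRate a b u u' z * gWeight a b (z + 1) = gWeight a b z * birthRate a b u u' z :=
  div_mul_cancel₀ _ (gWeight_pos ha hb _).ne'

theorem hiddenDeathRate_mul (ha : -1 < a) (hb : -1 < b) (u u' : ℂ) (z : ℕ) :
    hiddenDeathRate a b u u' z * gWeight a b z =
      gWeight a b (z + 1) * deathRate a b u u' (z + 1) :=
  div_mul_cancel₀ _ (gWeight_pos ha hb _).ne'

/-- Summation against `g` intertwines the generators of the chain and of the hidden chain, up to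
the eigenvalue of `g`. -/
theorem generator_cumSum (ha : -1 < a) (hb : -1 < b) (u u' : ℂ) (h : ℕ → ℝ) (z : ℕ) :
    generator (hiddenBirthRate a b u u') (hiddenDeathRate a b u u') (cumSum a b h) z =
      cumSum a b (generator (birthRate a b u u') (deathRate a b u u') h) z -
        gEigenvalue a b u u' * cumSum a b h z := by
  -- Summation by parts: as `g` is an eigenmeasure, only boundary terms at `z` remain.
  have h1 : cumSum a b (generator (birthRate a b u u') (deathRate a b u u') h) z =
      gEigenvalue a b u u' * cumSum a b h z + gWeight a b z * birthRate a b u u' z * h (z + 1) -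
        gWeight a b (z + 1) * deathRate a b u u' (z + 1) * h z := by
    induction z with
    | zero =>
      have := gWeight_eigenmeasure_zero ha hb u u'
      simp only [cumSum, zero_add, Finset.range_one, Finset.sum_singleton, generator,
        deathRate_zero]
      rw [this]
      ring
    | succ z ih =>
      have := gWeight_eigenmeasure_succ ha hb u u' z
      rw [cumSum_succ, cumSum_succ, ih, generator, if_neg (Nat.succ_ne_zero z),
        Nat.add_sub_cancel]
      linear_combination h (z + 1) * this
  have h2 := hiddenBirthRate_mul ha hb u u' z
  have h3 := hiddenDeathRate_mul ha hb u u' z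
  rw [h1, generator, cumSum_succ, ← h2, ← h3]
  cases z with
  | zero => simp [cumSum]; ring
  | succ z =>
    rw [if_neg (Nat.succ_ne_zero z), Nat.add_sub_cancel, cumSum_succ]
    ring

theorem cumSum_chamberPoly (ha : -1 < a) (hb : -1 < b) (j z : ℕ) :
    cumSum a b (fun y => chamberPoly (a + b + 1) j y) z =
      cumWeight a b z * ((a + 1) / (a + 1 + j) * chamberPoly (a + b + 2) j z) := by
  have h1 : a + 1 ≠ 0 := by linarith
  have hj : (0 : ℝ) ≤ j := Nat.cast_nonneg j
  have h2 : a + 1 + j ≠ 0 := by linarith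
  induction z with
  | zero =>
    rw [cumSum, zero_add, Finset.range_one, Finset.sum_singleton, gWeight_zero ha]
    cases j with
    | zero => simp [chamberPoly, h1]
    | succ j => simp [chamberPoly_succ_zero]
  | succ z ih =>
    have hz : (0 : ℝ) ≤ z := Nat.cast_nonneg z
    have h3 : (z : ℝ) + b + 1 ≠ 0 := by linarith
    have h4 : (z : ℝ) + 1 ≠ 0 := by linarith
    rw [cumSum_succ, ih, gWeight_succ ha hb, cumWeight_succ ha hb]
    have e1 := add_mul_chamberPoly_add_one (a + b + 1) j ((z + 1 : ℕ) : ℝ)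
    have e2 := mul_chamberPoly_add_one_sub_one (a + b + 1) j ((z + 1 : ℕ) : ℝ)
    push_cast at e1 e2 ⊢
    rw [add_sub_cancel_right] at e2
    rw [show a + b + 1 + 1 = a + b + 2 by ring] at e1 e2
    set r1 := chamberPoly (a + b + 2) j (z + 1)
    set r0 := chamberPoly (a + b + 2) j z
    set q := chamberPoly (a + b + 1) j (z + 1)
    field_simp
    linear_combination cumWeight a b z * (((z : ℝ) + b + 1) * e2 - (z + a + 2) * e1)

/-- The cumulated polynomials, weighted by `f`, are the increments of the next polynomial. -/
theorem fWeight_mul_cumSum (ha : -1 < a) (hb : -1 < b) (j z : ℕ) :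
    fWeight a b z * cumSum a b (fun y => chamberPoly (a + b + 1) j y) z =
      (chamberPoly (a + b + 1) (j + 1) (z + 1) - chamberPoly (a + b + 1) (j + 1) z) /
        ((a + 1 + j) * (j + 1)) := by
  have h1 : a + 1 ≠ 0 := by linarith
  have hj : (0 : ℝ) ≤ j := Nat.cast_nonneg j
  have h2 : a + 1 + j ≠ 0 := by linarith
  have h3 : (j : ℝ) + 1 ≠ 0 := by linarith
  have h4 := (cumWeight_pos ha hb z).ne'
  rw [cumSum_chamberPoly ha hb, fWeight_eq ha, chamberPoly_add_one_sub,
    show a + b + 1 + 1 = a + b + 2 by ring]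
  field_simp
  ring

/-- Summation of `f` against the cumulated polynomials yields the next polynomial. -/
theorem sum_fWeight_mul_cumSum (ha : -1 < a) (hb : -1 < b) (j x : ℕ) :
    ∑ z ∈ Finset.range x, fWeight a b z * cumSum a b (fun y => chamberPoly (a + b + 1) j y) z =
      chamberPoly (a + b + 1) (j + 1) x / ((a + 1 + j) * (j + 1)) := by
  simp only [fWeight_mul_cumSum ha hb]
  rw [← Finset.sum_div]
  have := Finset.sum_range_sub (fun z : ℕ => chamberPoly (a + b + 1) (j + 1) (z : ℝ)) x
  push_cast at this
  rw [this, chamberPoly_succ_zero, sub_zero]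

/-! ### The hidden chain and the weight `f` -/

/-- The constant by which the hidden chain differs from the differences of the chain with
parameters `u + 1`, `u' + 1`. -/
def fEigenvalue (a b : ℝ) (u u' : ℂ) : ℝ := a * (a + b + 3 + (u + u').re)

theorem re_add_one (u u' : ℂ) : (u + 1 + (u' + 1)).re = (u + u').re + 2 := by
  simp
  ring

theorem re_mul_add_one (u u' : ℂ) :
    ((u + 1) * (u' + 1)).re = (u * u').re + (u + u').re + 1 := by
  simp
  ring

/-- With `deathRate_shift_mul_fWeight` and `birthRate_shift_add_deathRate_shift`, the comparison of the
coefficients of the two sides of `generator_diff`. -/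
theorem birthRate_shift_mul_fWeight (ha : -1 < a) (hb : -1 < b) (u u' : ℂ) (x : ℕ) :
    birthRate a b (u + 1) (u' + 1) (x + 1) * fWeight a b (x + 1) =
      hiddenBirthRate a b u u' x * fWeight a b x := by
  have hx : (0 : ℝ) ≤ x := Nat.cast_nonneg x
  have h1 : a + 1 ≠ 0 := by linarith
  have h2 := (cumWeight_pos ha hb x).ne'
  have h3 : (x : ℝ) + b + 1 ≠ 0 := by linarith
  have h4 : (x : ℝ) + 1 ≠ 0 := by linarith
  have h5 : (x : ℝ) * 2 + a + b + 2 ≠ 0 := by linarith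
  have h6 : (x : ℝ) * 2 + a + b + 3 ≠ 0 := by linarith
  have h7 : (x : ℝ) * 2 + a + b + 4 ≠ 0 := by linarith
  have h8 : (x : ℝ) + a + b + 2 ≠ 0 := by linarith
  have h9 : (x : ℝ) + a + 2 ≠ 0 := by linarith
  rw [hiddenBirthRate, gWeight_mul_birthRate ha hb, birthRate_succ, re_add_one, re_mul_add_one,
    fWeight_eq ha, fWeight_eq ha, cumWeight_succ ha hb, gWeight_succ ha hb]
  push_cast
  rw [show 2 * ((x : ℝ) + 1) + a + b + 2 = 2 * x + a + b + 4 by ring]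
  field_simp
  ring

theorem hiddenDeathRate_zero (ha : -1 < a) (hb : -1 < b) (u u' : ℂ) :
    hiddenDeathRate a b u u' 0 =
      (a + 1) * ((a + b + 2) ^ 2 + (a + b + 2) * (u + u').re + (u * u').re) / (a + b + 2) := by
  have h2 := (cumWeight_pos ha hb 0).ne'
  have h := gWeight_mul_deathRate ha hb u u' 0
  rw [hiddenDeathRate, h, gWeight_zero ha]
  simp
  field_simp

theorem hiddenDeathRate_succ (ha : -1 < a) (hb : -1 < b) (u u' : ℂ) (x : ℕ) :
    hiddenDeathRate a b u u' (x + 1) = (x + a + b + 2) * (x + a + 2) *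
      ((x + a + b + 3) ^ 2 + (x + a + b + 3) * (u + u').re + (u * u').re) /
        ((2 * x + a + b + 3) * (2 * x + a + b + 4)) := by
  have hx : (0 : ℝ) ≤ x := Nat.cast_nonneg x
  have h1 : a + 1 ≠ 0 := by linarith
  have h2 := (cumWeight_pos ha hb x).ne'
  have h3 : (x : ℝ) + b + 1 ≠ 0 := by linarith
  have h4 : (x : ℝ) + 1 ≠ 0 := by linarith
  have h6 : (x : ℝ) * 2 + a + b + 3 ≠ 0 := by linarith
  have h7 : (x : ℝ) * 2 + a + b + 4 ≠ 0 := by linarith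
  have h := gWeight_mul_deathRate ha hb u u' (x + 1)
  rw [hiddenDeathRate, h, gWeight_succ ha hb, cumWeight_succ ha hb]
  push_cast
  rw [show 2 * ((x : ℝ) + 1) + a + b + 2 = 2 * x + a + b + 4 by ring,
    show (x : ℝ) + 1 + a + b + 2 = x + a + b + 3 by ring]
  field_simp

theorem hiddenBirthRate_eq (ha : -1 < a) (hb : -1 < b) (u u' : ℂ) (x : ℕ) :
    hiddenBirthRate a b u u' x = (x + 1) * (x + b + 1) *
      (x ^ 2 - x * (u + u').re + (u * u').re) /
        ((2 * x + a + b + 2) * (2 * x + a + b + 3)) := by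
  have hx : (0 : ℝ) ≤ x := Nat.cast_nonneg x
  have h1 : a + 1 ≠ 0 := by linarith
  have h2 := (cumWeight_pos ha hb x).ne'
  have h3 : (x : ℝ) + b + 1 ≠ 0 := by linarith
  have h4 : (x : ℝ) + 1 ≠ 0 := by linarith
  have h5 : (x : ℝ) * 2 + a + b + 2 ≠ 0 := by linarith
  have h6 : (x : ℝ) * 2 + a + b + 3 ≠ 0 := by linarith
  rw [hiddenBirthRate, gWeight_mul_birthRate ha hb, gWeight_succ ha hb]
  field_simp

theorem deathRate_shift_mul_fWeight (ha : -1 < a) (hb : -1 < b) (u u' : ℂ) (x : ℕ) :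
    deathRate a b (u + 1) (u' + 1) (x + 1) * fWeight a b x =
      hiddenDeathRate a b u u' (x + 1) * fWeight a b (x + 1) := by
  have hx : (0 : ℝ) ≤ x := Nat.cast_nonneg x
  have h1 : a + 1 ≠ 0 := by linarith
  have h2 := (cumWeight_pos ha hb x).ne'
  have h3 : (x : ℝ) + b + 1 ≠ 0 := by linarith
  have h4 : (x : ℝ) + 1 ≠ 0 := by linarith
  have h5 : (x : ℝ) * 2 + a + b + 2 ≠ 0 := by linarith
  have h6 : (x : ℝ) * 2 + a + b + 3 ≠ 0 := by linarith
  have h7 : (x : ℝ) * 2 + a + b + 4 ≠ 0 := by linarith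
  have h8 : (x : ℝ) + a + b + 2 ≠ 0 := by linarith
  have h9 : (x : ℝ) + a + 2 ≠ 0 := by linarith
  rw [hiddenDeathRate_succ ha hb, deathRate_succ, re_add_one, re_mul_add_one,
    fWeight_eq ha, fWeight_eq ha, cumWeight_succ ha hb]
  push_cast
  rw [show 2 * ((x : ℝ) + 1) + a + b + 2 = 2 * x + a + b + 4 by ring]
  field_simp
  ring

theorem birthRate_shift_add_deathRate_shift (ha : -1 < a) (hb : -1 < b) (u u' : ℂ) (x : ℕ) :
    birthRate a b (u + 1) (u' + 1) x + deathRate a b (u + 1) (u' + 1) (x + 1) =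
      hiddenBirthRate a b u u' x + hiddenDeathRate a b u u' x - fEigenvalue a b u u' := by
  rw [hiddenBirthRate_eq ha hb, deathRate_succ, re_add_one, re_mul_add_one, fEigenvalue]
  cases x with
  | zero =>
    have h5 : a + b + 2 ≠ 0 := by linarith
    have h6 : a + b + 3 ≠ 0 := by linarith
    rw [hiddenDeathRate_zero ha hb, birthRate_zero, re_mul_add_one]
    simp only [Nat.cast_zero, zero_add, mul_zero]
    field_simp
    ring
  | succ x =>
    have hx : (0 : ℝ) ≤ x := Nat.cast_nonneg x
    have h6 : (x : ℝ) * 2 + a + b + 3 ≠ 0 := by linarith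
    have h7 : (x : ℝ) * 2 + a + b + 4 ≠ 0 := by linarith
    have h8 : (x : ℝ) * 2 + a + b + 5 ≠ 0 := by linarith
    rw [hiddenDeathRate_succ ha hb, birthRate_succ, re_add_one, re_mul_add_one]
    push_cast
    rw [show 2 * ((x : ℝ) + 1) + a + b + 2 = 2 * x + a + b + 4 by ring,
      show 2 * ((x : ℝ) + 1) + a + b + 3 = 2 * x + a + b + 5 by ring]
    field_simp
    ring

/-- The weighted differences `(h x - h (x + 1)) / f x` intertwine the generator of the chain with
parameters `u + 1`, `u' + 1` and that of the hidden chain. -/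
theorem generator_diff (ha : -1 < a) (hb : -1 < b) (u u' : ℂ) (h : ℕ → ℝ) (x : ℕ) :
    generator (hiddenBirthRate a b u u') (hiddenDeathRate a b u u')
        (fun x => (h x - h (x + 1)) / fWeight a b x) x =
      (generator (birthRate a b (u + 1) (u' + 1)) (deathRate a b (u + 1) (u' + 1)) h x -
        generator (birthRate a b (u + 1) (u' + 1)) (deathRate a b (u + 1) (u' + 1)) h (x + 1)) /
          fWeight a b x - fEigenvalue a b u u' * ((h x - h (x + 1)) / fWeight a b x) := by
  have f0 := (fWeight_pos ha hb x).ne'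
  have f1 := (fWeight_pos ha hb (x + 1)).ne'
  have e1 := birthRate_shift_mul_fWeight ha hb u u' x
  have e2 := birthRate_shift_add_deathRate_shift ha hb u u' x
  have e1' : hiddenBirthRate a b u u' x = birthRate a b (u + 1) (u' + 1) (x + 1) *
      fWeight a b (x + 1) / fWeight a b x := by
    rw [e1]; field_simp
  cases x with
  | zero =>
    simp only [generator, if_true, deathRate_zero, Nat.succ_ne_zero, if_false, zero_add] at *
    rw [show hiddenDeathRate a b u u' 0 = birthRate a b (u + 1) (u' + 1) 0 +
      deathRate a b (u + 1) (u' + 1) 1 - hiddenBirthRate a b u u' 0 + fEigenvalue a b u u' by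
      linarith, e1']
    field_simp
    ring
  | succ x =>
    have f2 := (fWeight_pos ha hb x).ne'
    have e3 := deathRate_shift_mul_fWeight ha hb u u' x
    have e3' : deathRate a b (u + 1) (u' + 1) (x + 1) = hiddenDeathRate a b u u' (x + 1) *
      fWeight a b (x + 1) / fWeight a b x := by
      rw [← e3]; field_simp
    simp only [generator, Nat.succ_ne_zero, if_false, Nat.add_sub_cancel]
    rw [show fEigenvalue a b u u' = hiddenBirthRate a b u u' (x + 1) +
      hiddenDeathRate a b u u' (x + 1) - (birthRate a b (u + 1) (u' + 1) (x + 1) +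
        deathRate a b (u + 1) (u' + 1) (x + 1 + 1)) by linarith, e1', e3']
    field_simp
    ring

end

/-! ### Growth of the rates and of the polynomials -/

section Growth

open Asymptotics Filter

theorem isTheta_linear {α : ℝ} (hα : α ≠ 0) (c : ℝ) :
    (fun N : ℕ => α * (N : ℝ) + c) =Θ[atTop] fun N : ℕ => (N : ℝ) := by
  have h1 : (fun N : ℕ => α * (N : ℝ)) =Θ[atTop] fun N : ℕ => (N : ℝ) :=
    (isTheta_const_mul_left hα).2 (isTheta_refl _ _)
  have h2 : (fun _ : ℕ => c) =o[atTop] fun N : ℕ => (N : ℝ) :=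
    (isLittleO_const_id_atTop c).comp_tendsto tendsto_natCast_atTop_atTop
  exact h1.add_isLittleO h2

theorem isTheta_natCast_add (c : ℝ) :
    (fun N : ℕ => (N : ℝ) + c) =Θ[atTop] fun N : ℕ => (N : ℝ) := by
  simpa using isTheta_linear one_ne_zero c

theorem isTheta_chamberPoly_add (s c : ℝ) (j : ℕ) :
    (fun N : ℕ => chamberPoly s j (N + c)) =Θ[atTop] fun N : ℕ => (N : ℝ) ^ (2 * j) := by
  induction j with
  | zero => simp [chamberPoly]
  | succ j ih =>
    have h1 : (fun N : ℕ => (N : ℝ) + c - j) =Θ[atTop] fun N : ℕ => (N : ℝ) := by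
      simpa [add_sub_assoc] using isTheta_natCast_add (c - j)
    have h2 : (fun N : ℕ => (N : ℝ) + c + s + j) =Θ[atTop] fun N : ℕ => (N : ℝ) := by
      simpa [add_assoc] using isTheta_natCast_add (c + (s + j))
    have h3 := ih.mul (h1.mul h2)
    have e : (fun N : ℕ => (N : ℝ) ^ (2 * (j + 1))) =
        fun N : ℕ => (N : ℝ) ^ (2 * j) * ((N : ℝ) * N) := by
      funext N; ring
    rw [e]
    simpa only [chamberPoly_succ] using h3

theorem isTheta_chamberPoly (s : ℝ) (j : ℕ) :
    (fun N : ℕ => chamberPoly s j N) =Θ[atTop] fun N : ℕ => (N : ℝ) ^ (2 * j) := by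
  simpa using isTheta_chamberPoly_add s 0 j

theorem isLittleO_natCast_pow {p q : ℕ} (h : p < q) :
    (fun N : ℕ => (N : ℝ) ^ p) =o[atTop] fun N : ℕ => (N : ℝ) ^ q :=
  (isLittleO_pow_pow_atTop_of_lt h).comp_tendsto tendsto_natCast_atTop_atTop

theorem isBigO_quadratic (v m : ℝ) :
    (fun N : ℕ => (N : ℝ) ^ 2 - N * v + m) =O[atTop] fun N : ℕ => (N : ℝ) ^ 2 := by
  have h0 : (fun N : ℕ => (N : ℝ) ^ 2) =O[atTop] fun N : ℕ => (N : ℝ) ^ 2 := isBigO_refl _ _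
  have h1 : (fun N : ℕ => (N : ℝ) * v) =O[atTop] fun N : ℕ => (N : ℝ) ^ 2 := by
    have := (isLittleO_natCast_pow (show 1 < 2 by norm_num)).isBigO.const_mul_left v
    simpa [mul_comm] using this
  have h2 : (fun _ : ℕ => m) =O[atTop] fun N : ℕ => (N : ℝ) ^ 2 := by
    have := (isLittleO_natCast_pow (show 0 < 2 by norm_num)).isBigO.const_mul_left m
    simpa using this
  exact (h0.sub h1).add h2

/-- A ratio of products of two linear factors is bounded. -/
theorem isBigO_ratio_mul {c₁ c₂ d₁ d₂ α₁ α₂ : ℝ} (h₁ : α₁ ≠ 0) (h₂ : α₂ ≠ 0) {f : ℕ → ℝ} {k : ℕ}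
    (hf : f =O[atTop] fun N : ℕ => (N : ℝ) ^ k) :
    (fun N : ℕ => ((N : ℝ) + c₁) * (N + c₂) / ((α₁ * N + d₁) * (α₂ * N + d₂)) * f N) =O[atTop]
      fun N : ℕ => (N : ℝ) ^ k := by
  have h := (((isTheta_natCast_add c₁).mul (isTheta_natCast_add c₂)).div
    ((isTheta_linear h₁ d₁).mul (isTheta_linear h₂ d₂))).isBigO.mul hf
  refine h.trans (EventuallyEq.isBigO ?_)
  filter_upwards [eventually_gt_atTop 0] with N hN
  have : (N : ℝ) ≠ 0 := by exact_mod_cast hN.ne'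
  field_simp

theorem isBigO_birthRate (a b : ℝ) (u u' : ℂ) :
    birthRate a b u u' =O[atTop] fun N : ℕ => (N : ℝ) ^ 2 := by
  have h := isBigO_ratio_mul (c₁ := a + b + 1) (c₂ := a + 1) (d₁ := a + b + 1) (d₂ := a + b + 2)
    (two_ne_zero (α := ℝ)) two_ne_zero (isBigO_quadratic (u + u').re (u * u').re)
  refine (EventuallyEq.isBigO ?_).trans h
  filter_upwards [eventually_gt_atTop 0] with N hN
  rw [birthRate_eq_mul, betaQuotient, if_neg hN.ne', div_mul_div_comm, div_mul_eq_mul_div]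
  congr 1 <;> ring

theorem isBigO_hiddenBirthRate {a b : ℝ} (ha : -1 < a) (hb : -1 < b) (u u' : ℂ) :
    hiddenBirthRate a b u u' =O[atTop] fun N : ℕ => (N : ℝ) ^ 2 := by
  have h := isBigO_ratio_mul (c₁ := 1) (c₂ := b + 1) (d₁ := a + b + 2) (d₂ := a + b + 3)
    (two_ne_zero (α := ℝ)) two_ne_zero (isBigO_quadratic (u + u').re (u * u').re)
  refine (EventuallyEq.isBigO (Eventually.of_forall fun N => ?_)).trans h
  simp only [hiddenBirthRate_eq ha hb]
  rw [div_mul_eq_mul_div]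
  congr 1 <;> ring

end Growth

/-! ### The three chains as triangular chains -/

section Chains

open Asymptotics Filter

variable {a b : ℝ} {u u' : ℂ}

/-- The chain acts triangularly on the polynomials `chamberPoly`. Its birth rate grows at most
quadratically, so two more degrees outweigh the exit to infinity. -/
theorem triangularChain_chamberPoly (ha : -1 < a) (hb : -1 < b) (hpos : PositiveRates a b u u') :
    TriangularChain (birthRate a b u u') (deathRate a b u u')
      (fun j x => chamberPoly (a + b + 1) j x) (diagCoeff b u u') (lowerCoeff a u u') where
  lam_nonneg x := (hpos.1 x).le
  mu_nonneg x := by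
    rcases Nat.eq_zero_or_pos x with rfl | hx
    · rw [deathRate_zero]
    · exact (hpos.2 x hx).le
  nonneg j x := chamberPoly_nonneg (by linarith) j x
  pos x := by simp [chamberPoly]
  generator_zero x := by
    cases x <;> simp [chamberPoly, generator, diagCoeff, deathRate_zero]
  generator_succ j x := generator_chamberPoly_succ ha hb u u' j x
  growth j := by
    refine ⟨j + 2, ?_⟩
    have h1 := (isBigO_birthRate a b u u').mul (isTheta_chamberPoly_add (a + b + 1) 1 j).isBigO
    have h2 := h1.trans_isLittleO ((isLittleO_natCast_pow
      (show 2 + 2 * j < 2 * (j + 2) by omega)).congr_left fun N => pow_add _ _ _)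
    simpa using h2.trans_isBigO (isTheta_chamberPoly (a + b + 1) (j + 2)).2

/-- The image of `triangularChain_chamberPoly` under summation against `g`. The growth condition
holds because the cumulated polynomials are `cumWeight` times polynomials. -/
theorem triangularChain_hidden (ha : -1 < a) (hb : -1 < b) (hpos : PositiveRates a b u u') :
    TriangularChain (hiddenBirthRate a b u u') (hiddenDeathRate a b u u')
      (fun j z => cumSum a b (fun y => chamberPoly (a + b + 1) j y) z)
      (fun j => diagCoeff b u u' j - gEigenvalue a b u u') (lowerCoeff a u u') where
  lam_nonneg x := div_nonneg (mul_nonneg (gWeight_pos ha hb _).le (hpos.1 x).le)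
    (gWeight_pos ha hb _).le
  mu_nonneg x := div_nonneg (mul_nonneg (gWeight_pos ha hb _).le (hpos.2 _ (Nat.succ_pos x)).le)
    (gWeight_pos ha hb _).le
  nonneg j x := Finset.sum_nonneg fun y _ => mul_nonneg (gWeight_pos ha hb y).le
    (chamberPoly_nonneg (by linarith) j y)
  pos x := Finset.sum_pos (fun y _ => by simpa [chamberPoly] using gWeight_pos ha hb y)
    (Finset.nonempty_range_iff.2 (Nat.succ_ne_zero x))
  generator_zero x := by
    have H := triangularChain_chamberPoly ha hb hpos
    have h := generator_cumSum ha hb u u' (fun y => chamberPoly (a + b + 1) 0 y) x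
    rw [h, sub_mul]
    congr 1
    simp only [cumSum, H.generator_zero, Finset.mul_sum]
    exact Finset.sum_congr rfl fun y _ => by ring
  generator_succ j x := by
    have H := triangularChain_chamberPoly ha hb hpos
    have h := generator_cumSum ha hb u u' (fun y => chamberPoly (a + b + 1) (j + 1) y) x
    rw [h, sub_mul, sub_add_eq_add_sub]
    congr 1
    simp only [cumSum, H.generator_succ, Finset.mul_sum, ← Finset.sum_add_distrib]
    exact Finset.sum_congr rfl fun y _ => by ring
  growth j := by
    refine ⟨j + 2, ?_⟩
    simp only [cumSum_chamberPoly ha hb]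
    have hj0 : ∀ j : ℕ, (a + 1) / (a + 1 + j) ≠ 0 := fun j => by
      have : (0 : ℝ) ≤ j := Nat.cast_nonneg j
      exact div_ne_zero (by linarith) (by linarith)
    have h0 := (isBigO_hiddenBirthRate ha hb u u').mul
      ((isTheta_chamberPoly_add (a + b + 2) 1 j).isBigO.const_mul_left ((a + 1) / (a + 1 + j)))
    have h0' := h0.congr_right (g₂ := fun N : ℕ => (N : ℝ) ^ (2 + 2 * j))
      fun N => (pow_add _ _ _).symm
    have h1 := isBigO_ratio_mul (c₁ := a + b + 2) (c₂ := a + 2) (d₁ := 1) (d₂ := b + 1)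
      (one_ne_zero (α := ℝ)) one_ne_zero h0'
    have h2 := (h1.trans_isLittleO (isLittleO_natCast_pow
      (show 2 + 2 * j < 2 * (j + 2) by omega))).trans_isBigO
      (((isTheta_const_mul_left (hj0 (j + 2))).2 (isTheta_chamberPoly (a + b + 2) (j + 2))).2)
    have h3 := (isBigO_refl (cumWeight a b) atTop).mul_isLittleO h2
    refine h3.congr_left fun N => ?_
    rw [cumWeight_succ ha hb]
    push_cast
    rw [one_mul, ← add_assoc, ← add_assoc, ← add_assoc]
    ring

end Chains

/-! ### One-particle intertwinings -/

section OneParticle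

open Filter Topology

theorem generator_const_mul (lam mu h : ℕ → ℝ) (c : ℝ) (x : ℕ) :
    generator lam mu (fun y => c * h y) x = c * generator lam mu h x := by
  unfold generator
  split_ifs <;> ring

theorem hasDerivAt_exp_mul (c : ℝ) {r : ℝ → ℝ} {r' s : ℝ} (hr : HasDerivAt r r' s) :
    HasDerivAt (fun s => Real.exp (-(c * s)) * r s) (Real.exp (-(c * s)) * (r' - c * r s)) s := by
  have h : HasDerivAt (fun s => Real.exp (-(c * s))) (Real.exp (-(c * s)) * (-(c * 1))) s :=
    (((hasDerivAt_id s).const_mul c).neg).exp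
  exact (h.mul hr).congr_deriv (by ring)

theorem exp_neg_mul_le {c s t : ℝ} (hs : s ∈ Set.Icc 0 t) :
    Real.exp (-(c * s)) ≤ Real.exp (|c| * t) := by
  refine Real.exp_le_exp.2 ?_
  calc -(c * s) = (-c) * s := by ring
    _ ≤ |c| * s := mul_le_mul_of_nonneg_right (neg_le_abs c) hs.1
    _ ≤ |c| * t := mul_le_mul_of_nonneg_left hs.2 (abs_nonneg c)

variable {a b : ℝ} {u u' : ℂ}

/-- The truncated densities of the chain are bounded locally uniformly in time. -/
theorem exists_truncatedDensity_le (ha : -1 < a) (hb : -1 < b) (hpos : PositiveRates a b u u')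
    (t : ℝ) : ∃ E, 0 ≤ E ∧ ∀ N, ∀ s ∈ Set.Icc 0 t, ∀ x y,
      |truncatedDensity (birthRate a b u u') (deathRate a b u u') N s x y| ≤ E := by
  have H := triangularChain_chamberPoly ha hb hpos
  obtain ⟨C, hw⟩ := H.isLyapunov_weight 0
  refine ⟨Real.exp (|(-C)| * t), (Real.exp_pos _).le, fun N s hs x y => ?_⟩
  rw [abs_of_nonneg (truncatedDensity_nonneg hw.lam_nonneg hw.mu_nonneg hs.1 x y)]
  refine (hw.truncatedDensity_le N hs.1 x y).trans (le_trans (le_of_eq ?_) (exp_neg_mul_le hs))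
  simp [TriangularChain.weight, chamberPoly]

/-- Summation against `g` intertwines the one-particle semigroups of the chain and of the hidden
chain. -/
theorem hasSum_hidden_mul_indicator (ha : -1 < a) (hb : -1 < b) (hpos : PositiveRates a b u u')
    {t : ℝ} (ht : 0 ≤ t) (z y : ℕ) :
    (Summable fun w => |transitionDensity (hiddenBirthRate a b u u') (hiddenDeathRate a b u u')
        t z w * if y ≤ w then gWeight a b y else 0|) ∧
      HasSum (fun w => transitionDensity (hiddenBirthRate a b u u') (hiddenDeathRate a b u u')
          t z w * if y ≤ w then gWeight a b y else 0)
        (Real.exp (-(gEigenvalue a b u u' * t)) * cumSum a b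
          (fun y' => transitionDensity (birthRate a b u u') (deathRate a b u u') t y' y) z) := by
  have H := triangularChain_chamberPoly ha hb hpos
  have H' := triangularChain_hidden ha hb hpos
  obtain ⟨K, -, hK⟩ := H'.growth_weight 0
  obtain ⟨C, hw⟩ := H'.isLyapunov_weight K
  obtain ⟨C₀, hw₀⟩ := H.isLyapunov_weight 0
  obtain ⟨E, hE0, hE⟩ := exists_truncatedDensity_le ha hb hpos t
  set κ := gEigenvalue a b u u'
  set lam := birthRate a b u u'
  set mu := deathRate a b u u'
  set lam' := hiddenBirthRate a b u u'
  set mu' := hiddenDeathRate a b u u'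
  set b' : ℕ → ℕ → ℝ := fun j z => cumSum a b (fun y => chamberPoly (a + b + 1) j y) z
  have hb'0 : ∀ z, b' 0 z = ∑ y ∈ Finset.range (z + 1), gWeight a b y := fun z => by
    simp [b', cumSum, chamberPoly]
  have hg := gWeight_pos ha hb
  have hdom : ∀ w, |if y ≤ w then gWeight a b y else 0| ≤ 1 * TriangularChain.weight b' K w := by
    intro w
    rw [one_mul]
    split_ifs with hyw
    · rw [abs_of_pos (hg y)]
      refine le_trans ?_ (H'.le_weight (Nat.zero_le K) w)
      change _ ≤ b' 0 w
      rw [hb'0]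
      exact Finset.single_le_sum (f := gWeight a b) (fun i _ => (hg i).le)
        (Finset.mem_range.2 (by omega))
    · rw [abs_zero]
      exact (H'.weight_pos K w).le
  have hs := hw.summable_abs_transitionDensity_mul ht z hdom
  refine ⟨hs, ?_⟩
  -- The right-hand side for the truncated chain solves the backward equation of the hidden chain.
  set v : ℕ → ℝ → ℕ → ℝ := fun N s z => Real.exp (-(κ * s)) *
    cumSum a b (fun y' => truncatedDensity lam mu (N + 1) s y' y) z with hv_def
  have hv : ∀ N s, ∀ z ≤ N, HasDerivAt (fun s => v N s z) (generator lam' mu' (v N s) z) s := by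
    intro N s z hz
    have h1 : HasDerivAt (fun s => cumSum a b
        (fun y' => truncatedDensity lam mu (N + 1) s y' y) z)
        (cumSum a b (generator lam mu fun y' => truncatedDensity lam mu (N + 1) s y' y) z) s :=
      HasDerivAt.fun_sum fun y' hy' => (hasDerivAt_truncatedDensity_backward
        (by have := Finset.mem_range.1 hy'; omega) y s).const_mul _
    refine (hasDerivAt_exp_mul κ h1).congr_deriv ?_
    rw [hv_def, generator_const_mul, generator_cumSum ha hb]
  have hB : ∀ N, ∀ s ∈ Set.Icc 0 t, |v N s (N + 1)| ≤
      Real.exp (|κ| * t) * E * TriangularChain.weight b' 0 (N + 1) := by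
    intro N s hs
    have h1 : |cumSum a b (fun y' => truncatedDensity lam mu (N + 1) s y' y) (N + 1)| ≤
        E * TriangularChain.weight b' 0 (N + 1) := by
      have : TriangularChain.weight b' 0 (N + 1) = b' 0 (N + 1) := by
        simp [TriangularChain.weight]
      rw [this, hb'0, Finset.mul_sum]
      refine (Finset.abs_sum_le_sum_abs _ _).trans (Finset.sum_le_sum fun y' _ => ?_)
      rw [abs_mul, abs_of_pos (hg y'), mul_comm]
      exact mul_le_mul_of_nonneg_right (hE _ s hs _ _) (hg y').le
    rw [hv_def]
    simp only
    rw [abs_mul, abs_of_pos (Real.exp_pos _), mul_assoc]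
    exact mul_le_mul (exp_neg_mul_le hs) h1 (abs_nonneg _) (Real.exp_pos _).le
  have h1 := hw.tendsto_sum_truncatedDensity_sub ht z hv hB (by
    refine (hK.const_mul_left (Real.exp (|κ| * t) * E)).congr_left fun N => by ring)
  have h2 := hw.tendsto_sum_truncatedDensity ht z hdom
  have h3 : Tendsto (fun N => v N t z) atTop (𝓝 (Real.exp (-(κ * t)) * cumSum a b
      (fun y' => transitionDensity lam mu t y' y) z)) :=
    (tendsto_finsetSum _ fun y' _ => ((hw₀.tendsto_truncatedDensity ht y' y).comp
      (tendsto_add_atTop_nat 1)).const_mul _).const_mul _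
  have h4 : ∀ N, ∑ w ∈ Finset.range (N + 1), truncatedDensity lam' mu' (N + 1) t z w * v N 0 w =
      ∑ w ∈ Finset.range (N + 1), truncatedDensity lam' mu' (N + 1) t z w *
        if y ≤ w then gWeight a b y else 0 := by
    intro N
    refine Finset.sum_congr rfl fun w hw => ?_
    congr 1
    have hw' := Finset.mem_range.1 hw
    simp only [hv_def, mul_zero, neg_zero, Real.exp_zero, one_mul, cumSum]
    rw [Finset.sum_congr rfl fun y' hy' => by
      rw [truncatedDensity_zero (show y' < N + 1 by have := Finset.mem_range.1 hy'; omega)]]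
    simp
  simp only [h4] at h1
  have h5 := h1.add h2
  simp only [sub_add_cancel, zero_add] at h5
  rw [tendsto_nhds_unique h3 h5]
  exact hs.of_abs.hasSum

/-- The chain with parameters `u + 1`, `u' + 1` and the hidden chain are in Siegmund-type duality
with respect to the weight `f`. -/
theorem fWeight_mul_sum_sub (ha : -1 < a) (hb : -1 < b) (hpos : PositiveRates a b u u')
    (hpos1 : PositiveRates a b (u + 1) (u' + 1)) {t : ℝ} (ht : 0 ≤ t) (x z : ℕ) :
    fWeight a b z * (∑ y ∈ Finset.range (z + 1), transitionDensity
        (birthRate a b (u + 1) (u' + 1)) (deathRate a b (u + 1) (u' + 1)) t x y -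
      ∑ y ∈ Finset.range (z + 1), transitionDensity
        (birthRate a b (u + 1) (u' + 1)) (deathRate a b (u + 1) (u' + 1)) t (x + 1) y) =
      Real.exp (fEigenvalue a b u u' * t) * (fWeight a b x *
        transitionDensity (hiddenBirthRate a b u u') (hiddenDeathRate a b u u') t x z) := by
  have H := triangularChain_chamberPoly ha hb hpos1
  have H' := triangularChain_hidden ha hb hpos
  obtain ⟨K, -, hK⟩ := H'.growth_weight 0
  obtain ⟨C, hw⟩ := H'.isLyapunov_weight K
  obtain ⟨C₀, hw₀⟩ := H.isLyapunov_weight 0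
  obtain ⟨E, hE0, hE⟩ := exists_truncatedDensity_le ha hb hpos1 t
  set κ := fEigenvalue a b u u' with hκ
  set lam := birthRate a b (u + 1) (u' + 1) with hlam
  set mu := deathRate a b (u + 1) (u' + 1) with hmu
  set lam' := hiddenBirthRate a b u u' with hlam'
  set mu' := hiddenDeathRate a b u u' with hmu'
  set b' : ℕ → ℕ → ℝ := fun j z => cumSum a b (fun y => chamberPoly (a + b + 1) j y) z with hb'
  have hf := fWeight_pos ha hb
  -- The truncation at `N + 2` makes `r N s (x + 1)` solve the backward equation for `x ≤ N`.
  set r : ℕ → ℝ → ℕ → ℝ := fun N s x =>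
    ∑ y ∈ Finset.range (z + 1), truncatedDensity lam mu (N + 2) s x y with hr_def
  set v : ℕ → ℝ → ℕ → ℝ := fun N s x => Real.exp (-(κ * s)) *
    ((r N s x - r N s (x + 1)) / fWeight a b x) with hv_def
  have hr : ∀ N s, ∀ x ≤ N + 1,
      HasDerivAt (fun s => r N s x) (generator lam mu (r N s) x) s := by
    intro N s x hx
    have h1 : HasDerivAt (fun s => r N s x) (∑ y ∈ Finset.range (z + 1),
        generator lam mu (fun k => truncatedDensity lam mu (N + 2) s k y) x) s :=
      HasDerivAt.fun_sum fun y _ => hasDerivAt_truncatedDensity_backward hx y s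
    have h2 := generator_sum lam mu (Finset.range (z + 1)) (fun _ => 1)
      (fun y k => truncatedDensity lam mu (N + 2) s k y) x
    simp only [mul_one] at h2
    rw [← h2] at h1
    exact h1
  have hv : ∀ N s, ∀ x ≤ N, HasDerivAt (fun s => v N s x) (generator lam' mu' (v N s) x) s := by
    intro N s x hx
    refine (hasDerivAt_exp_mul κ
      (((hr N s x (by omega)).sub (hr N s (x + 1) (by omega))).div_const _)).congr_deriv ?_
    rw [hv_def, generator_const_mul, hlam', hmu', generator_diff ha hb]
    rfl
  have hrb : ∀ N, ∀ s ∈ Set.Icc 0 t, ∀ x, |r N s x| ≤ (z + 1) * E := by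
    intro N s hs x
    refine (Finset.abs_sum_le_sum_abs _ _).trans ((Finset.sum_le_sum fun y _ =>
      hE _ s hs _ _).trans ?_)
    simp
  have hB : ∀ N, ∀ s ∈ Set.Icc 0 t, |v N s (N + 1)| ≤
      Real.exp (|κ| * t) * (2 * ((z + 1) * E)) * (a + 1) *
        TriangularChain.weight b' 0 (N + 1) := by
    intro N s hs
    have h1 : |r N s (N + 1) - r N s (N + 1 + 1)| ≤ 2 * ((z + 1) * E) := by
      have h1 := abs_sub (r N s (N + 1)) (r N s (N + 1 + 1))
      have h2 := hrb N s hs (N + 1)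
      have h3 := hrb N s hs (N + 1 + 1)
      linarith
    have h2 : (fWeight a b (N + 1))⁻¹ ≤ (a + 1) * TriangularChain.weight b' 0 (N + 1) := by
      have e : TriangularChain.weight b' 0 (N + 1) = cumWeight a b (N + 1) := by
        have : a + 1 ≠ 0 := by linarith
        simp only [TriangularChain.weight, hb', zero_add, Finset.range_one, Finset.sum_singleton,
          cumSum_chamberPoly ha hb]
        simp [chamberPoly, this]
      have hN : (0 : ℝ) ≤ N := Nat.cast_nonneg N
      rw [e, fWeight_eq ha, inv_div]
      refine div_le_self (mul_nonneg (by linarith) (cumWeight_pos ha hb _).le) ?_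
      push_cast
      linarith
    have hz0 : (0 : ℝ) ≤ 2 * ((z + 1) * E) := by positivity
    simp only [hv_def]
    rw [abs_mul, abs_of_pos (Real.exp_pos _), abs_div, abs_of_pos (hf _), div_eq_mul_inv,
      mul_assoc (Real.exp (|κ| * t) * (2 * ((z + 1) * E))), mul_assoc (Real.exp (|κ| * t))]
    refine mul_le_mul (exp_neg_mul_le hs) (mul_le_mul h1 h2 (inv_pos.2 (hf _)).le hz0) ?_
      (Real.exp_pos _).le
    exact mul_nonneg (abs_nonneg _) (inv_pos.2 (hf _)).le
  have h1 := hw.tendsto_sum_truncatedDensity_sub ht x hv hB (by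
    refine (hK.const_mul_left (Real.exp (|κ| * t) * (2 * ((z + 1) * E)) * (a + 1))).congr_left
      fun N => by ring)
  have hr_lim : ∀ x, Tendsto (fun N => r N t x) atTop
      (𝓝 (∑ y ∈ Finset.range (z + 1), transitionDensity lam mu t x y)) := fun x =>
    tendsto_finsetSum _ fun y _ => (hw₀.tendsto_truncatedDensity ht x y).comp
      (tendsto_add_atTop_nat 2)
  have h3 : Tendsto (fun N => v N t x) atTop (𝓝 (Real.exp (-(κ * t)) *
      ((∑ y ∈ Finset.range (z + 1), transitionDensity lam mu t x y -
        ∑ y ∈ Finset.range (z + 1), transitionDensity lam mu t (x + 1) y) / fWeight a b x))) :=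
    (((hr_lim x).sub (hr_lim (x + 1))).div_const _).const_mul _
  have h4 : ∀ N, z ≤ N → ∑ w ∈ Finset.range (N + 1),
      truncatedDensity lam' mu' (N + 1) t x w * v N 0 w =
      truncatedDensity lam' mu' (N + 1) t x z * (fWeight a b z)⁻¹ := by
    intro N hN
    have hr0 : ∀ w ≤ N + 1, r N 0 w = if w ≤ z then 1 else 0 := by
      intro w hw
      simp only [hr_def]
      rw [Finset.sum_congr rfl fun y _ => truncatedDensity_zero (show w < N + 2 by omega)]
      simp
    rw [Finset.sum_eq_single z]
    · simp only [hv_def]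
      rw [hr0 z (by omega), hr0 (z + 1) (by omega)]
      simp
    · intro w hw hwz
      have := Finset.mem_range.1 hw
      simp only [hv_def]
      rw [hr0 w (by omega), hr0 (w + 1) (by omega)]
      rcases lt_or_gt_of_ne hwz with h | h
      · simp [h.le, show w + 1 ≤ z by omega]
      · simp [show ¬ w ≤ z by omega, show ¬ w + 1 ≤ z by omega]
    · intro hz
      exact absurd (Finset.mem_range.2 (by omega)) hz
  have h2 : Tendsto (fun N => ∑ w ∈ Finset.range (N + 1),
      truncatedDensity lam' mu' (N + 1) t x w * v N 0 w) atTop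
      (𝓝 (transitionDensity lam' mu' t x z * (fWeight a b z)⁻¹)) := by
    refine Tendsto.congr' ?_ (((hw.tendsto_truncatedDensity ht x z).comp
      (tendsto_add_atTop_nat 1)).mul_const _)
    filter_upwards [eventually_ge_atTop z] with N hN
    exact (h4 N hN).symm
  have h5 := h1.add h2
  simp only [sub_add_cancel, zero_add] at h5
  have h6 := tendsto_nhds_unique h3 h5
  have f1 := (hf x).ne'
  have f2 := (hf z).ne'
  have e : Real.exp (κ * t) ≠ 0 := (Real.exp_pos _).ne'
  rw [Real.exp_neg] at h6
  field_simp at h6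
  linear_combination h6

/-- The chain is conservative, so that the masses of half-lines are complementary. -/
theorem hasSum_mul_indicator_lt (ha : -1 < a) (hb : -1 < b) (hpos : PositiveRates a b u u')
    {t : ℝ} (ht : 0 ≤ t) (x z : ℕ) (c : ℝ) :
    (Summable fun w => |transitionDensity (birthRate a b u u') (deathRate a b u u') t x w *
      if z < w then c else 0|) ∧
    HasSum (fun w => transitionDensity (birthRate a b u u') (deathRate a b u u') t x w *
        if z < w then c else 0)
      (c * (1 - ∑ y ∈ Finset.range (z + 1),
        transitionDensity (birthRate a b u u') (deathRate a b u u') t x y)) := by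
  have H := triangularChain_chamberPoly ha hb hpos
  obtain ⟨C₀, hw₀⟩ := H.isLyapunov_weight 0
  refine ⟨hw₀.summable_abs_transitionDensity_mul ht x (C := |c|) fun y => ?_, ?_⟩
  · have : |c| * TriangularChain.weight
        (fun j (x : ℕ) => chamberPoly (a + b + 1) j x) 0 y = |c| := by
      simp [TriangularChain.weight, chamberPoly]
    rw [this]
    split_ifs
    · exact le_rfl
    · simp
  set p := fun w => transitionDensity (birthRate a b u u') (deathRate a b u u') t x w
  have h1 : HasSum p 1 := by
    have := H.hasSum_zero ht x
    simpa [chamberPoly, diagCoeff] using this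
  have h2 : HasSum (fun w => if w ∈ Finset.range (z + 1) then p w else 0)
      (∑ y ∈ Finset.range (z + 1), p y) := by
    have : HasSum (fun w => if w ∈ Finset.range (z + 1) then p w else 0)
        (∑ w ∈ Finset.range (z + 1), if w ∈ Finset.range (z + 1) then p w else 0) :=
      hasSum_sum_of_ne_finset_zero fun w hw => if_neg hw
    rwa [Finset.sum_congr rfl fun y hy => if_pos hy] at this
  refine ((h1.sub h2).mul_left c).congr_fun fun w => ?_
  by_cases h : z < w
  · have h' : ¬ w < z + 1 := by omega
    simp [h, h', p, mul_comm]
  · have h' : w < z + 1 := by omega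
    simp [h, h']

end OneParticle

/-! ### Determinantal formulas for the eigenfunctions -/

section Determinants

variable {a b : ℝ}

theorem mem_Wnn {n : ℕ} {z y : W n} : y ∈ Wnn z ↔ InterlaceEq z y := by
  simp [Wnn]

theorem mem_Wsucc {n : ℕ} {x : W (n + 1)} {z : W n} : z ∈ Wsucc x ↔ InterlaceSucc x z := by
  simp [Wsucc]

/-- `F_n` is the Vandermonde determinant in `(x_i+s/2)²`, which does not change when the powers are
replaced by the monic polynomials `chamberPoly`. -/
theorem F_eq_det {n : ℕ} (x : W n) :
    F a b x = Matrix.det (Matrix.of fun i j : Fin n => chamberPoly (a + b + 1) j (x.1 i)) := by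
  set s := a + b + 1 with hs
  set p : Fin n → Polynomial ℝ := fun j =>
    ∏ i ∈ Finset.range j, (Polynomial.X - Polynomial.C (((i : ℝ) + s / 2) ^ 2)) with hp
  have hmonic : ∀ j, (p j).Monic := fun j =>
    Polynomial.monic_prod_of_monic _ _ fun i _ => Polynomial.monic_X_sub_C _
  have hdeg : ∀ j, (p j).natDegree = j := fun j => by
    rw [hp, Polynomial.natDegree_prod_of_monic _ _ fun i _ => Polynomial.monic_X_sub_C _,
      Finset.sum_congr rfl fun i _ => Polynomial.natDegree_X_sub_C _]
    simp
  have h := Matrix.det_eval_matrixOfPolynomials_eq_det_vandermonde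
    (fun i => ((x.1 i : ℝ) + s / 2) ^ 2) p hdeg hmonic
  rw [Matrix.det_vandermonde] at h
  rw [F, h]
  congr 1
  ext i j
  simp only [hp, Matrix.of_apply, Polynomial.eval_prod, Polynomial.eval_sub, Polynomial.eval_X,
    Polynomial.eval_C, chamberPoly]
  exact Finset.prod_congr rfl fun k _ => by ring

theorem F_pos (ha : -1 < a) (hb : -1 < b) {n : ℕ} (x : W n) : 0 < F a b x := by
  refine Finset.prod_pos fun i _ => Finset.prod_pos fun j hj => ?_
  have hij : x.1 i + 1 ≤ x.1 j := x.2 (Finset.mem_Ioi.1 hj)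
  have hij' : (x.1 i : ℝ) + 1 ≤ x.1 j := by exact_mod_cast hij
  have h0 : (0 : ℝ) ≤ x.1 i := Nat.cast_nonneg _
  nlinarith

theorem finset_sum_eq_of_hasSum {n : ℕ} {D : Finset (W n)} {w G : W n → ℝ} {S : ℝ}
    (h : HasSum (fun y => (if y ∈ D then w y else 0) * G y) S) : ∑ y ∈ D, w y * G y = S := by
  have h1 : HasSum (fun y => (if y ∈ D then w y else 0) * G y)
      (∑ y ∈ D, (if y ∈ D then w y else 0) * G y) :=
    hasSum_sum_of_ne_finset_zero fun y hy => by rw [if_neg hy, zero_mul]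
  rw [h.unique h1]
  exact (Finset.sum_congr rfl fun y hy => by rw [if_pos hy]).symm

/-- Summation of a determinant over `W^{n,n}(z)` is summation over each entry. -/
theorem sum_Wnn_det {n : ℕ} (z : W n) (B : ℕ → Fin n → ℝ) :
    ∑ y ∈ Wnn z, (∏ i, gWeight a b (y.1 i)) * Matrix.det (Matrix.of fun i j => B (y.1 i) j) =
      Matrix.det (Matrix.of fun i j => cumSum a b (fun y => B y j) (z.1 i)) := by
  classical
  have h0 : ∀ (i k : Fin n) (y : ℕ), y ∉ Finset.range (z.1 i + 1) →
      (if y ≤ z.1 i then gWeight a b y else 0) * B y k = 0 := by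
    intro i k y hy
    have : ¬ y ≤ z.1 i := by simpa [Nat.lt_succ_iff] using hy
    rw [if_neg this, zero_mul]
  have h := hasSum_det_mul_det (fun i y => if y ≤ z.1 i then gWeight a b y else 0) B fun i k =>
    summable_of_ne_finset_zero (s := Finset.range (z.1 i + 1)) fun y hy => by
      rw [h0 i k y hy, abs_zero]
  have e : ∀ i k, ∑' y, (if y ≤ z.1 i then gWeight a b y else 0) * B y k =
      cumSum a b (fun y => B y k) (z.1 i) := by
    intro i k
    rw [tsum_eq_sum fun y hy => h0 i k y hy, cumSum]
    refine Finset.sum_congr rfl fun y hy => ?_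
    rw [if_pos (by have := Finset.mem_range.1 hy; omega)]
  simp only [e] at h
  refine finset_sum_eq_of_hasSum (h.congr_fun fun y => ?_)
  have := det_le_eq_interlaceEq z y (gWeight a b)
  rw [this]
  simp only [mem_Wnn]

/-- Summation of a determinant over `W^{n,n+1}(x)` is summation over each entry. -/
theorem sum_Wsucc_det {n : ℕ} (x : W (n + 1)) (B : ℕ → Fin n → ℝ) :
    ∑ z ∈ Wsucc x, (∏ i, fWeight a b (z.1 i)) * Matrix.det (Matrix.of fun i j => B (z.1 i) j) =
      Matrix.det (Matrix.of fun i j : Fin n =>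
        ∑ w ∈ Finset.range (x.1 i.succ), fWeight a b w * B w j -
          ∑ w ∈ Finset.range (x.1 i.castSucc), fWeight a b w * B w j) := by
  classical
  have h1 : ∀ (m : ℕ) (k : Fin n),
      HasSum (fun w => (if w < m then fWeight a b w else 0) * B w k)
        (∑ w ∈ Finset.range m, fWeight a b w * B w k) := by
    intro m k
    have : HasSum (fun w => (if w < m then fWeight a b w else 0) * B w k)
        (∑ w ∈ Finset.range m, (if w < m then fWeight a b w else 0) * B w k) :=
      hasSum_sum_of_ne_finset_zero fun w hw => by
        rw [if_neg (by simpa using hw), zero_mul]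
    rwa [Finset.sum_congr rfl fun w hw => by rw [if_pos (Finset.mem_range.1 hw)]] at this
  have h2 : ∀ i k : Fin n, HasSum (fun w => ((if w < x.1 i.succ then fWeight a b w else 0) -
      if w < x.1 i.castSucc then fWeight a b w else 0) * B w k)
      (∑ w ∈ Finset.range (x.1 i.succ), fWeight a b w * B w k -
          ∑ w ∈ Finset.range (x.1 i.castSucc), fWeight a b w * B w k) := fun i k =>
    ((h1 _ k).sub (h1 _ k)).congr_fun fun w => by ring
  have h := hasSum_det_mul_det (fun (i : Fin n) w =>
    (if w < x.1 i.succ then fWeight a b w else 0) -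
      if w < x.1 i.castSucc then fWeight a b w else 0) B fun i k => (h2 i k).summable.abs
  simp only [fun i k => (h2 i k).tsum_eq] at h
  refine finset_sum_eq_of_hasSum (h.congr_fun fun z => ?_)
  have := det_diff_eq_interlaceSucc x z (fWeight a b)
  rw [this]
  simp only [mem_Wsucc]

theorem Fhat_eq_det {n : ℕ} (z : W n) :
    Fhat a b z = Matrix.det (Matrix.of fun i j : Fin n =>
      cumSum a b (fun y => chamberPoly (a + b + 1) j y) (z.1 i)) := by
  simp only [Fhat, F_eq_det]
  exact sum_Wnn_det z fun y j => chamberPoly (a + b + 1) j y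

theorem Fhat_pos (ha : -1 < a) (hb : -1 < b) {n : ℕ} (z : W n) : 0 < Fhat a b z := by
  refine Finset.sum_pos (fun y _ => mul_pos (Finset.prod_pos fun i _ => gWeight_pos ha hb _)
    (F_pos ha hb y)) ⟨z, mem_Wnn.2 ⟨fun i => le_rfl, fun i j hij => z.2 ?_⟩⟩
  rw [Fin.lt_def]
  omega

theorem prod_add_mul_eq_gamma (ha : -1 < a) (n : ℕ) :
    (∏ j : Fin n, (a + 1 + (j : ℕ)) * ((j : ℕ) + 1)) * Real.Gamma (a + 1) =
      (n.factorial : ℝ) * Real.Gamma (n + a + 1) := by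
  induction n with
  | zero => simp
  | succ n ih =>
    have hn : (0 : ℝ) ≤ n := Nat.cast_nonneg n
    have g : Real.Gamma (((n + 1 : ℕ) : ℝ) + a + 1) = (n + a + 1) * Real.Gamma (n + a + 1) := by
      rw [← Real.Gamma_add_one (by linarith)]; push_cast; congr 1; ring
    rw [Fin.prod_univ_castSucc, g, Nat.factorial_succ]
    simp only [Fin.val_castSucc, Fin.val_last]
    push_cast
    linear_combination (a + 1 + n) * (n + 1) * ih

/-- `F̄_{n+1}` is a multiple of `F_{n+1}`. -/
theorem Fbar_eq (ha : -1 < a) (hb : -1 < b) {n : ℕ} (x : W (n + 1)) :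
    Fbar a b x = Real.Gamma (a + 1) / (n.factorial * Real.Gamma (n + a + 1)) * F a b x := by
  have h := sum_Wsucc_det (a := a) (b := b) x fun w (j : Fin n) =>
    cumSum a b (fun y => chamberPoly (a + b + 1) j y) w
  simp only [Fbar, Fhat_eq_det]
  rw [h]
  have e : (Matrix.of fun i j : Fin n =>
      ∑ w ∈ Finset.range (x.1 i.succ),
          fWeight a b w * cumSum a b (fun y => chamberPoly (a + b + 1) j y) w -
        ∑ w ∈ Finset.range (x.1 i.castSucc),
          fWeight a b w * cumSum a b (fun y => chamberPoly (a + b + 1) j y) w) =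
      Matrix.of fun i j : Fin n => ((a + 1 + (j : ℕ)) * ((j : ℕ) + 1))⁻¹ *
        (Matrix.of fun i j : Fin n => chamberPoly (a + b + 1) (j + 1) (x.1 i.succ) -
          chamberPoly (a + b + 1) (j + 1) (x.1 i.castSucc)) i j := by
    ext i j
    simp only [Matrix.of_apply, sum_fWeight_mul_cumSum ha hb]
    ring
  have e2 : (Matrix.of fun i (j : Fin (n + 1)) => (Fin.cons 1 (fun j : Fin n =>
      chamberPoly (a + b + 1) (j + 1) (x.1 i)) : Fin (n + 1) → ℝ) j) =
      Matrix.of fun i (j : Fin (n + 1)) => chamberPoly (a + b + 1) j (x.1 i) := by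
    ext i j
    refine Fin.cases ?_ (fun k => ?_) j
    · simp [chamberPoly]
    · simp
  rw [e, Matrix.det_mul_row, ← det_cons_one (fun i (j : Fin n) =>
    chamberPoly (a + b + 1) (j + 1) (x.1 i)), e2, ← F_eq_det, Finset.prod_inv_distrib]
  have hg := prod_add_mul_eq_gamma ha n
  have hG : Real.Gamma (a + 1) ≠ 0 := (Real.Gamma_pos_of_pos (by linarith)).ne'
  have hP : ∏ j : Fin n, (a + 1 + (j : ℕ)) * ((j : ℕ) + 1) ≠ 0 :=
    Finset.prod_ne_zero_iff.2 fun j _ => by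
      have : (0 : ℝ) ≤ (j : ℕ) := Nat.cast_nonneg _
      exact mul_ne_zero (by linarith) (by linarith)
  rw [← hg]
  field_simp

theorem gamma_div_pos (ha : -1 < a) (n : ℕ) :
    0 < Real.Gamma (a + 1) / (n.factorial * Real.Gamma (n + a + 1)) := by
  have hn : (0 : ℝ) ≤ n := Nat.cast_nonneg n
  have h1 : 0 < Real.Gamma (a + 1) := Real.Gamma_pos_of_pos (by linarith)
  have h2 : 0 < Real.Gamma (n + a + 1) := Real.Gamma_pos_of_pos (by linarith)
  have h3 : (0 : ℝ) < n.factorial := by exact_mod_cast n.factorial_pos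
  positivity

theorem Fbar_pos (ha : -1 < a) (hb : -1 < b) {n : ℕ} (x : W (n + 1)) : 0 < Fbar a b x := by
  rw [Fbar_eq ha hb]
  exact mul_pos (gamma_div_pos ha n) (F_pos ha hb x)

/-- The kernel of the branching graph factorizes through the hidden configurations. -/
theorem linkBC_eq_comp (ha : -1 < a) (hb : -1 < b) {n : ℕ} (f : W n → ℝ) :
    linkBC a b f = linkSucc a b (linkEq a b f) := by
  classical
  funext x
  have h1 : ∑ z ∈ Wsucc x, linkEq a b f z * (∏ i, fWeight a b (z.1 i)) * Fhat a b z =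
      ∑ z ∈ Wsucc x, ∑ y ∈ Wnn z, F a b y * f y *
        (2 ^ n * ∏ i, BWeight a b (z.1 i) (y.1 i)) := by
    refine Finset.sum_congr rfl fun z _ => ?_
    have := (Fhat_pos ha hb z).ne'
    rw [linkEq, mul_assoc, mul_assoc, mul_comm _ (Fhat a b z), mul_left_comm _ (Fhat a b z),
      ← mul_assoc (Fhat a b z)⁻¹, inv_mul_cancel₀ this, one_mul, Finset.sum_mul]
    refine Finset.sum_congr rfl fun y _ => ?_
    simp only [BWeight, Finset.prod_mul_distrib, Finset.prod_const, Finset.card_univ,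
      Fintype.card_fin, one_div, inv_pow]
    have : (2 : ℝ) ^ n ≠ 0 := by positivity
    field_simp
  have h2 : ∑ z ∈ Wsucc x, ∑ y ∈ Wnn z, F a b y * f y *
        (2 ^ n * ∏ i, BWeight a b (z.1 i) (y.1 i)) =
      ∑ y ∈ WBC x, ∑ z ∈ intermediate x y, F a b y * f y *
        (2 ^ n * ∏ i, BWeight a b (z.1 i) (y.1 i)) := by
    refine Finset.sum_comm' fun z y => ?_
    simp only [mem_Wnn, mem_Wsucc, WBC, intermediate, Set.Finite.mem_toFinset, Set.mem_ofPred_eq,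
      Finset.mem_filter]
    exact ⟨fun ⟨h1, h2⟩ => ⟨⟨h1, h2⟩, z, h2, h1⟩, fun ⟨h, _⟩ => h⟩
  rw [linkSucc, h1, h2, linkBC, Fbar_eq ha hb]
  simp only [← Finset.mul_sum, ← mul_assoc]
  simp only [mul_right_comm _ ((2 : ℝ) ^ n), ← Finset.sum_mul]
  have hn : (0 : ℝ) ≤ n := Nat.cast_nonneg n
  have g1 : Real.Gamma (a + 1) ≠ 0 := (Real.Gamma_pos_of_pos (by linarith)).ne'
  have g2 : Real.Gamma (n + a + 1) ≠ 0 := (Real.Gamma_pos_of_pos (by linarith)).ne'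
  have g3 : (n.factorial : ℝ) ≠ 0 := by exact_mod_cast n.factorial_ne_zero
  have g4 := (F_pos ha hb x).ne'
  field_simp

end Determinants

/-! ### Intertwining of the Karlin-McGregor semigroups -/

section KarlinMcGregor

variable {a b : ℝ} {u u' : ℂ}

open Classical in
/-- The unnormalized link along `W^{n,n}` intertwines the Karlin-McGregor densities: the Cauchy-Binet
formula applied to `hasSum_hidden_mul_indicator`. -/
theorem hasSum_kmDensity_mul_interlaceEq (ha : -1 < a) (hb : -1 < b)
    (hpos : PositiveRates a b u u') {t : ℝ} (ht : 0 ≤ t) {n : ℕ} (z y : W n) :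
    HasSum (fun z' : W n =>
        kmDensity (hiddenBirthRate a b u u') (hiddenDeathRate a b u u') t z z' *
          if y ∈ Wnn z' then ∏ i, gWeight a b (y.1 i) else 0)
      (Real.exp (-(n * gEigenvalue a b u u') * t) * ∑ y' ∈ Wnn z, (∏ i, gWeight a b (y'.1 i)) *
        kmDensity (birthRate a b u u') (deathRate a b u u') t y' y) := by
  have h1 := fun i k : Fin n => hasSum_hidden_mul_indicator ha hb hpos ht (z.1 i) (y.1 k)
  have h := hasSum_det_mul_det
    (fun i w => transitionDensity (hiddenBirthRate a b u u') (hiddenDeathRate a b u u') t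
      (z.1 i) w)
    (fun w k => if y.1 k ≤ w then gWeight a b (y.1 k) else 0) fun i k => (h1 i k).1
  simp only [fun i k => (h1 i k).2.tsum_eq] at h
  have h2 := sum_Wnn_det (a := a) (b := b) z fun w (k : Fin n) =>
    transitionDensity (birthRate a b u u') (deathRate a b u u') t w (y.1 k)
  have h3 : Matrix.det (Matrix.of fun i k : Fin n =>
      Real.exp (-(gEigenvalue a b u u' * t)) * cumSum a b (fun y' =>
        transitionDensity (birthRate a b u u') (deathRate a b u u') t y' (y.1 k)) (z.1 i)) =
      Real.exp (-(n * gEigenvalue a b u u') * t) * ∑ y' ∈ Wnn z, (∏ i, gWeight a b (y'.1 i)) *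
        kmDensity (birthRate a b u u') (deathRate a b u u') t y' y := by
    simp only [kmDensity]
    rw [h2, show (Matrix.of fun i k : Fin n =>
      Real.exp (-(gEigenvalue a b u u' * t)) * cumSum a b (fun y' =>
        transitionDensity (birthRate a b u u') (deathRate a b u u') t y' (y.1 k)) (z.1 i)) =
      Real.exp (-(gEigenvalue a b u u' * t)) • Matrix.of fun i k : Fin n => cumSum a b (fun y' =>
        transitionDensity (birthRate a b u u') (deathRate a b u u') t y' (y.1 k)) (z.1 i)
      from rfl, Matrix.det_smul, Fintype.card_fin, ← Real.exp_nat_mul]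
    congr 2
    ring
  rw [← h3]
  refine h.congr_fun fun z' => ?_
  rw [det_le_eq_interlaceEq z' y (gWeight a b)]
  simp only [mem_Wnn]
  rfl

open Classical in
/-- The unnormalized link along `W^{n,n+1}` intertwines the Karlin-McGregor densities. Its indicator is
a determinant of size `n + 1` bordered by a column of ones, which the conservative chain preserves;
taking differences of rows reduces the size to `n`. -/
theorem hasSum_kmDensity_mul_interlaceSucc (ha : -1 < a) (hb : -1 < b)
    (hpos : PositiveRates a b u u') (hpos1 : PositiveRates a b (u + 1) (u' + 1)) {t : ℝ}
    (ht : 0 ≤ t) {n : ℕ} (x : W (n + 1)) (z : W n) :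
    HasSum (fun x' : W (n + 1) =>
        kmDensity (birthRate a b (u + 1) (u' + 1)) (deathRate a b (u + 1) (u' + 1)) t x x' *
          if z ∈ Wsucc x' then ∏ i, fWeight a b (z.1 i) else 0)
      (Real.exp (n * fEigenvalue a b u u' * t) * ∑ z' ∈ Wsucc x, (∏ i, fWeight a b (z'.1 i)) *
        kmDensity (hiddenBirthRate a b u u') (hiddenDeathRate a b u u') t z' z) := by
  set p := transitionDensity (birthRate a b (u + 1) (u' + 1)) (deathRate a b (u + 1) (u' + 1)) t
    with hp
  set p' := transitionDensity (hiddenBirthRate a b u u') (hiddenDeathRate a b u u') t with hp'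
  set κ := fEigenvalue a b u u'
  set B : ℕ → Fin (n + 1) → ℝ := fun w =>
    Fin.cons 1 fun k => if z.1 k < w then fWeight a b (z.1 k) else 0 with hB
  have H := triangularChain_chamberPoly ha hb hpos1
  have h1 : ∀ i k, (Summable fun w => |p (x.1 i) w * B w k|) ∧
      HasSum (fun w => p (x.1 i) w * B w k)
        ((Fin.cons 1 (fun k : Fin n => fWeight a b (z.1 k) *
          (1 - ∑ y ∈ Finset.range (z.1 k + 1), p (x.1 i) y)) : Fin (n + 1) → ℝ) k) := by
    intro i k
    refine Fin.cases ?_ (fun k => ?_) k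
    · have h := (H.hasSum_exp ht 1 0 (x.1 i)).1
      have h' := H.hasSum_zero ht (x.1 i)
      simp only [hB, Fin.cons_zero]
      exact ⟨by simpa [chamberPoly] using h, by simpa [chamberPoly, diagCoeff] using h'⟩
    · simp only [hB, Fin.cons_succ]
      exact hasSum_mul_indicator_lt ha hb hpos1 ht (x.1 i) (z.1 k) (fWeight a b (z.1 k))
  have h := hasSum_det_mul_det (fun i w => p (x.1 i) w) B fun i k => (h1 i k).1
  simp only [fun i k => (h1 i k).2.tsum_eq] at h
  rw [det_cons_one fun i (k : Fin n) => fWeight a b (z.1 k) *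
          (1 - ∑ y ∈ Finset.range (z.1 k + 1), p (x.1 i) y)] at h
  -- One-particle duality, summed from `0` to `x`.
  have h2 : ∀ (k : Fin n) (x : ℕ), fWeight a b (z.1 k) *
      (1 - ∑ y ∈ Finset.range (z.1 k + 1), p x y) =
      fWeight a b (z.1 k) * (1 - ∑ y ∈ Finset.range (z.1 k + 1), p 0 y) +
        Real.exp (κ * t) * ∑ w ∈ Finset.range x, fWeight a b w * p' w (z.1 k) := by
    intro k x
    induction x with
    | zero => simp
    | succ x ih =>
      have := fWeight_mul_sum_sub ha hb hpos hpos1 ht x (z.1 k)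
      rw [Finset.sum_range_succ (fun w => fWeight a b w * p' w (z.1 k)), mul_add, ← add_assoc, ← ih]
      linear_combination this
  have h3 : (Matrix.of fun i k : Fin n => fWeight a b (z.1 k) *
        (1 - ∑ y ∈ Finset.range (z.1 k + 1), p (x.1 i.succ) y) - fWeight a b (z.1 k) *
        (1 - ∑ y ∈ Finset.range (z.1 k + 1), p (x.1 i.castSucc) y)) =
      Real.exp (κ * t) • Matrix.of fun i k : Fin n =>
        ∑ w ∈ Finset.range (x.1 i.succ), fWeight a b w * p' w (z.1 k) -
          ∑ w ∈ Finset.range (x.1 i.castSucc), fWeight a b w * p' w (z.1 k) := by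
    ext i k
    rw [Matrix.smul_apply, Matrix.of_apply, Matrix.of_apply, h2 k (x.1 i.succ),
      h2 k (x.1 i.castSucc), smul_eq_mul]
    ring
  have h4 := sum_Wsucc_det (a := a) (b := b) x fun w (k : Fin n) => p' w (z.1 k)
  rw [h3, Matrix.det_smul, ← h4, Fintype.card_fin, ← Real.exp_nat_mul, ← mul_assoc] at h
  refine h.congr_fun fun x' => ?_
  have h5 := det_cons_one fun i (k : Fin n) =>
    if z.1 k < x'.1 i then fWeight a b (z.1 k) else 0
  simp only [hB]
  rw [h5, det_diff_eq_interlaceSucc x' z (fWeight a b)]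
  simp only [mem_Wsucc]
  rfl

end KarlinMcGregor

/-! ### Intertwining of `h`-transforms -/

/-- Fubini's theorem for the composition of a row `p` of a kernel with a nonnegative link `w` of
finite range. -/
theorem tsum_mul_finset_sum {S T : Type*} {D : S → Finset T} {w h f m : T → ℝ} {p hS : S → ℝ}
    {C : ℝ} [∀ s, DecidablePred (· ∈ D s)] (hw : ∀ τ, 0 ≤ w τ) (hh : ∀ τ, 0 ≤ h τ)
    (hhS : ∀ s, hS s = ∑ τ ∈ D s, w τ * h τ) (hf : ∀ τ, |f τ| ≤ C)
    (hsum : Summable fun s => |p s| * hS s)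
    (hm : ∀ τ, HasSum (fun s => p s * if τ ∈ D s then w τ else 0) (m τ)) :
    ∑' s, p s * ∑ τ ∈ D s, w τ * (h τ * f τ) = ∑' τ, m τ * (h τ * f τ) := by
  set G : S × T → ℝ := fun q => p q.1 * (if q.2 ∈ D q.1 then w q.2 else 0) * (h q.2 * f q.2)
  have h0 : ∀ s τ, τ ∉ D s → G (s, τ) = 0 := fun s τ hτ => by simp [G, hτ]
  have hG : Summable G := by
    refine Summable.of_abs ((summable_prod_of_nonneg fun q => abs_nonneg (G q)).2
      ⟨fun s => summable_of_ne_finset_zero (s := D s) fun τ hτ => by rw [h0 s τ hτ, abs_zero],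
        ?_⟩)
    refine Summable.of_nonneg_of_le (fun s => tsum_nonneg fun τ => abs_nonneg _) (fun s => ?_)
      (hsum.mul_left C)
    rw [tsum_eq_sum (s := D s) fun τ hτ => by rw [h0 s τ hτ, abs_zero], hhS, Finset.mul_sum,
      Finset.mul_sum]
    refine Finset.sum_le_sum fun τ hτ => ?_
    simp only [G, if_pos hτ, abs_mul, abs_of_nonneg (hw τ), abs_of_nonneg (hh τ)]
    calc |p s| * w τ * (h τ * |f τ|) = |p s| * (w τ * h τ) * |f τ| := by ring
      _ ≤ |p s| * (w τ * h τ) * C := mul_le_mul_of_nonneg_left (hf τ)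
          (mul_nonneg (abs_nonneg _) (mul_nonneg (hw τ) (hh τ)))
      _ = _ := by ring
  have h1 : ∀ s, p s * ∑ τ ∈ D s, w τ * (h τ * f τ) = ∑' τ, G (s, τ) := fun s => by
    rw [tsum_eq_sum (s := D s) fun τ hτ => h0 s τ hτ, Finset.mul_sum]
    refine Finset.sum_congr rfl fun τ hτ => ?_
    simp only [G, if_pos hτ]
    ring
  simp only [h1]
  rw [← Summable.tsum_comm (f := fun s τ => G (s, τ)) hG]
  exact tsum_congr fun τ => ((hm τ).mul_right (h τ * f τ)).tsum_eq

open Classical in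
/-- A link between the Karlin-McGregor semigroups of two families of chains, with weights `w` and
finite range `D`, becomes, once normalized, a link between their `h`-transforms. -/
theorem doobKM_intertwining {k n : ℕ} {lamS muS lamT muT : ℕ → ℝ} {D : W k → Finset (W n)}
    {w h f : W n → ℝ} {hS : W k → ℝ} {cS cT γ t C : ℝ} (hc : cS = cT + γ)
    (hw : ∀ τ, 0 ≤ w τ) (hh : ∀ τ, 0 < h τ) (hhS : ∀ s, hS s = ∑ τ ∈ D s, w τ * h τ)
    (hf : ∀ τ, |f τ| ≤ C)
    (hsumS : ∀ s, Summable fun s' => kmDensity lamS muS t s s' * hS s')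
    (hsumT : ∀ τ, Summable fun τ' => kmDensity lamT muT t τ τ' * h τ')
    (hS_pos : ∀ s, 0 < hS s)
    (hker : ∀ s τ, HasSum (fun s' => kmDensity lamS muS t s s' * if τ ∈ D s' then w τ else 0)
      (Real.exp (γ * t) * ∑ τ' ∈ D s, w τ' * kmDensity lamT muT t τ' τ)) (s : W k) :
    doobKM lamS muS hS cS t (fun s => (hS s)⁻¹ * ∑ τ ∈ D s, f τ * w τ * h τ) s =
      (hS s)⁻¹ * ∑ τ ∈ D s, doobKM lamT muT h cT t f τ * w τ * h τ := by
  have h1 : ∀ s', kmDensity lamS muS t s s' *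
      (hS s' * ((hS s')⁻¹ * ∑ τ ∈ D s', f τ * w τ * h τ)) =
      kmDensity lamS muS t s s' * ∑ τ ∈ D s', w τ * (h τ * f τ) := fun s' => by
    rw [mul_inv_cancel_left₀ (hS_pos s').ne']
    congr 1
    exact Finset.sum_congr rfl fun τ _ => by ring
  have h2 := tsum_mul_finset_sum (p := fun s' => kmDensity lamS muS t s s') hw
    (fun τ => (hh τ).le) hhS hf
    ((hsumS s).abs.congr fun s' => by rw [abs_mul, abs_of_pos (hS_pos s')]) (hker s)
  have hsumTf : ∀ τ', Summable fun τ => kmDensity lamT muT t τ' τ * (h τ * f τ) := fun τ' => by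
    refine Summable.of_abs (Summable.of_nonneg_of_le (fun τ => abs_nonneg _) (fun τ => ?_)
      ((hsumT τ').abs.mul_left C))
    rw [← mul_assoc, abs_mul, mul_comm C]
    exact mul_le_mul_of_nonneg_left (hf τ) (abs_nonneg _)
  have h3 : ∑' τ, (Real.exp (γ * t) * ∑ τ' ∈ D s, w τ' * kmDensity lamT muT t τ' τ) *
      (h τ * f τ) = Real.exp (γ * t) * ∑ τ' ∈ D s, w τ' *
        ∑' τ, kmDensity lamT muT t τ' τ * (h τ * f τ) := by
    simp only [mul_assoc, Finset.sum_mul]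
    rw [tsum_mul_left, Summable.tsum_finsetSum fun τ' _ => (hsumTf τ').mul_left _]
    simp only [tsum_mul_left]
  unfold doobKM
  simp only [h1]
  rw [h2, h3, mul_comm (Real.exp _) (hS s)⁻¹, mul_assoc, ← mul_assoc (Real.exp _),
    ← Real.exp_add, Finset.mul_sum]
  congr 1
  refine Finset.sum_congr rfl fun τ _ => ?_
  rw [show -(cS * t) + γ * t = -(cT * t) by rw [hc]; ring]
  have := (hh τ).ne'
  field_simp

theorem doobKM_const_mul {n : ℕ} (lam mu : ℕ → ℝ) {h h' : W n → ℝ} {K : ℝ} (hK : K ≠ 0)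
    (hh : ∀ x, h' x = K * h x) (c t : ℝ) (f : W n → ℝ) :
    doobKM lam mu h' c t f = doobKM lam mu h c t f := by
  funext x
  have h1 : ∀ y, kmDensity lam mu t x y * (h' y * f y) =
      K * (kmDensity lam mu t x y * (h y * f y)) := fun y => by rw [hh]; ring
  have h2 : ∑' y, kmDensity lam mu t x y * (h' y * f y) =
      K * ∑' y, kmDensity lam mu t x y * (h y * f y) := by
    simp only [h1, tsum_mul_left]
  rw [doobKM, doobKM, h2, hh, mul_inv]
  field_simp

theorem abs_linkEq_le {a b : ℝ} (ha : -1 < a) (hb : -1 < b) {n : ℕ} {f : W n → ℝ} {C : ℝ}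
    (hf : ∀ x, |f x| ≤ C) (z : W n) : |linkEq a b f z| ≤ C := by
  have hF := Fhat_pos ha hb z
  rw [linkEq, abs_mul, abs_of_pos (inv_pos.2 hF), inv_mul_le_iff₀ hF, Fhat, Finset.sum_mul]
  refine (Finset.abs_sum_le_sum_abs _ _).trans (Finset.sum_le_sum fun y _ => ?_)
  have h1 : 0 ≤ (∏ i, gWeight a b (y.1 i)) * F a b y :=
    mul_nonneg (Finset.prod_nonneg fun i _ => (gWeight_pos ha hb _).le) (F_pos ha hb y).le
  rw [mul_assoc, abs_mul, abs_of_nonneg h1, mul_comm]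
  exact mul_le_mul_of_nonneg_left (hf y) h1

theorem isPosEigenfunction_F {a b : ℝ} (ha : -1 < a) (hb : -1 < b) {u u' : ℂ}
    (hpos : PositiveRates a b u u') (n : ℕ) :
    IsPosEigenfunction (birthRate a b u u') (deathRate a b u u') (F a b : W n → ℝ)
      (eigenExponent b u u' n) := by
  refine ⟨F_pos ha hb, fun t ht x => ?_⟩
  have h := (triangularChain_chamberPoly ha hb hpos).hasSum_kmDensity ht x
  simp only [← F_eq_det, sum_diagCoeff] at h
  exact h

theorem isPosEigenfunction_Fhat {a b : ℝ} (ha : -1 < a) (hb : -1 < b) {u u' : ℂ}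
    (hpos : PositiveRates a b u u') (n : ℕ) :
    IsPosEigenfunction (hiddenBirthRate a b u u') (hiddenDeathRate a b u u')
      (Fhat a b : W n → ℝ) (eigenExponent b u u' n - n * gEigenvalue a b u u') := by
  refine ⟨Fhat_pos ha hb, fun t ht x => ?_⟩
  have h := (triangularChain_hidden ha hb hpos).hasSum_kmDensity ht x
  simp only [← Fhat_eq_det, Finset.sum_sub_distrib, sum_diagCoeff, Finset.sum_const,
    Finset.card_range, nsmul_eq_mul] at h
  exact h

/-- The exponents of the three eigenfunctions differ by the constants of the one-particle
intertwinings. -/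
theorem eigenExponent_succ (a b : ℝ) (u u' : ℂ) (n : ℕ) :
    eigenExponent b (u + 1) (u' + 1) (n + 1) =
      eigenExponent b u u' n - n * gEigenvalue a b u u' + n * fEigenvalue a b u u' := by
  rw [eigenExponent, eigenExponent, re_add_one, gEigenvalue, fEigenvalue]
  push_cast
  ring

end BCBranching

end

open BCBranching

theorem mainTheorem8 (a b : ℝ) (ha : -1 < a) (hb : -1 < b) (u u' : ℂ)
    (huu' : (u.im = 0 ∧ u'.im = 0) ∨ u' = (starRingEnd ℂ) u)
    (hpos : PositiveRates a b u u') (hpos1 : PositiveRates a b (u + 1) (u' + 1))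
    (n : ℕ) (hn : 1 ≤ n) :
    IsPosEigenfunction (birthRate a b u u') (deathRate a b u u')
      (F a b : W n → ℝ) (eigenExponent b u u' n) ∧
    IsPosEigenfunction (birthRate a b (u + 1) (u' + 1)) (deathRate a b (u + 1) (u' + 1))
      (F a b : W (n + 1) → ℝ) (eigenExponent b (u + 1) (u' + 1) (n + 1)) ∧
    (∀ x : W (n + 1), 0 < Fbar a b x) ∧
    (∀ f : W n → ℝ, linkBC a b f = linkSucc a b (linkEq a b f)) ∧
    ∃ chat : ℝ,
      IsPosEigenfunction (hiddenBirthRate a b u u') (hiddenDeathRate a b u u')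
        (Fhat a b : W n → ℝ) chat ∧
      ∀ t : ℝ, 0 ≤ t → ∀ f : W n → ℝ, (∃ C : ℝ, ∀ x, |f x| ≤ C) →
        doobKM (hiddenBirthRate a b u u') (hiddenDeathRate a b u u') (Fhat a b) chat t
            (linkEq a b f) =
          linkEq a b
            (doobKM (birthRate a b u u') (deathRate a b u u') (F a b)
              (eigenExponent b u u' n) t f) ∧
        doobKM (birthRate a b (u + 1) (u' + 1)) (deathRate a b (u + 1) (u' + 1)) (F a b)
            (eigenExponent b (u + 1) (u' + 1) (n + 1)) t (linkSucc a b f) =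
          linkSucc a b
            (doobKM (hiddenBirthRate a b u u') (hiddenDeathRate a b u u') (Fhat a b) chat t f) ∧
        doobKM (birthRate a b (u + 1) (u' + 1)) (deathRate a b (u + 1) (u' + 1)) (F a b)
            (eigenExponent b (u + 1) (u' + 1) (n + 1)) t (linkBC a b f) =
          linkBC a b
            (doobKM (birthRate a b u u') (deathRate a b u u') (F a b)
              (eigenExponent b u u' n) t f) := by
  have hE := isPosEigenfunction_F ha hb hpos n
  have hE1 := isPosEigenfunction_F ha hb hpos1 (n + 1)
  have hEh := isPosEigenfunction_Fhat ha hb hpos n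
  refine ⟨hE, hE1, Fbar_pos ha hb, linkBC_eq_comp ha hb, _, hEh, fun t ht f hf => ?_⟩
  have step1 : ∀ f : W n → ℝ, (∃ C : ℝ, ∀ x, |f x| ≤ C) →
      doobKM (hiddenBirthRate a b u u') (hiddenDeathRate a b u u') (Fhat a b)
        (eigenExponent b u u' n - n * gEigenvalue a b u u') t (linkEq a b f) =
        linkEq a b (doobKM (birthRate a b u u') (deathRate a b u u') (F a b)
          (eigenExponent b u u' n) t f) := by
    rintro f ⟨C, hC⟩
    funext z
    exact doobKM_intertwining (D := Wnn) (w := fun y => ∏ i, gWeight a b (y.1 i))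
      (γ := -(n * gEigenvalue a b u u')) (sub_eq_add_neg _ _)
      (fun y => Finset.prod_nonneg fun i _ => (gWeight_pos ha hb _).le) hE.1 (fun s => rfl) hC
      (fun s => (hEh.2 t ht s).summable) (fun s => (hE.2 t ht s).summable) hEh.1
      (hasSum_kmDensity_mul_interlaceEq ha hb hpos ht) z
  have step2 : ∀ f : W n → ℝ, (∃ C : ℝ, ∀ x, |f x| ≤ C) →
      doobKM (birthRate a b (u + 1) (u' + 1)) (deathRate a b (u + 1) (u' + 1)) (F a b)
        (eigenExponent b (u + 1) (u' + 1) (n + 1)) t (linkSucc a b f) =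
        linkSucc a b (doobKM (hiddenBirthRate a b u u') (hiddenDeathRate a b u u') (Fhat a b)
          (eigenExponent b u u' n - n * gEigenvalue a b u u') t f) := by
    rintro f ⟨C, hC⟩
    have hK := (gamma_div_pos ha n).ne'
    -- The link is normalized by `F̄`, so the `h`-transform by `F` is read as that by its multiple `F̄`.
    rw [← doobKM_const_mul _ _ hK (Fbar_eq ha hb)]
    funext x
    refine doobKM_intertwining (D := Wsucc) (hS := Fbar a b) (w := fun z => ∏ i, fWeight a b (z.1 i))
      (γ := n * fEigenvalue a b u u') (eigenExponent_succ a b u u' n)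
      (fun z => Finset.prod_nonneg fun i _ => (fWeight_pos ha hb _).le) hEh.1 (fun s => rfl) hC
      (fun s => ?_) (fun s => (hEh.2 t ht s).summable) (Fbar_pos ha hb)
      (hasSum_kmDensity_mul_interlaceSucc ha hb hpos hpos1 ht) x
    simp only [Fbar_eq ha hb]
    exact ((hE1.2 t ht s).summable.mul_left
      (Real.Gamma (a + 1) / (n.factorial * Real.Gamma (n + a + 1)))).congr fun y => by ring
  refine ⟨step1 f hf, step2 f hf, ?_⟩
  obtain ⟨C, hC⟩ := hf
  rw [linkBC_eq_comp ha hb, linkBC_eq_comp ha hb, step2 _ ⟨C, abs_linkEq_le ha hb hC⟩,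
    step1 f ⟨C, hC⟩]
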